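/- **Theorem (the general semi-Riemannian $G$-equivariant connection).** Let $(M,g)$ be a connected semi-Riemannian manifold of signature $(p,q)$ and dimension $n=p+q$, and let $O\in M$. Put $I_{p,q}=\mathrm{diag}(I_p,-I_q)$ and $$SO^+(p,q)=\{A\in GL_n(\mathbb R): A^TI_{p,q}A=I_{p,q},\ \det A=1,\ \det A_{1,1}>0\},$$ where $A_{1,1}$ is the upper left $p\times p$ block. Let $(U,x)$ be a chart of $M$ with $O\in U$ and $x(O)=0$, and let $\sigma$ be smooth tetrads on $U$, i.e. a smooth matrix-valued function with $g=\sigma^T I_{p,q}\,\sigma$ in the coordinates $x$. Let $\mathfrak k_O$ be the set of smooth vector fields $\xi$ on $M$ whose flow $Fl^\xi_t$ is defined for all times and consists of isometries of $M$ fixing $O$, and put $\psi_O(\xi)=\sigma(O)\exp(-\mathrm{Jac}_O\,\xi)\,\sigma(O)^{-1}$. Let $K_O$ be the subgroup of $GL_n(\mathbb R)$ generated by the matrices $\psi_O(\xi)$, $\xi\in\mathfrak k_O$. It acts on $M$ on the right by $R_{\psi_O(\xi)}=Fl^{\xi}_1$, extended multiplicatively. Write $L_\Lambda=R_{\Lambda^{-1}}$.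 Let $G$ be a Lie subgroup of $K_O$ with Lie algebra $\mathfrak g$, let $(P,\pi,M,G)$ be a principal fibre bundle with right action $u\mapsto u\cdot\Lambda$, and let $A\in\Omega^1(P,\mathfrak g)$ be a connection $1$-form on $P$. Let $s:U\to P$ be a smooth section that is $G$-equivariant for $A$: for all $\Lambda\in G$, $$A_{s(x)\cdot\Lambda}\circ T_x(s\cdot\Lambda)=A_{s(R_\Lambda x)}\circ T_x(s\circ R_\Lambda)\qquad\text{whenever } x,\,R_\Lambda x\in U .$$ Let $B=A^s=A_{s}\circ Ts$ be the local form of the connection, with components $B_\mu=B(\partial_\mu)$ in the chart. Then for all $\Lambda\in G$ and all $x\in U$ with $L_\Lambda x\in U$, the map $T_xL_\Lambda$ is invertible and $$B(L_\Lambda x)=Ad(\Lambda)\,B(x)\circ(T_xL_\Lambda)^{-1}.$$ For such $\Lambda$ and $x$ define $\tilde\Lambda(x)$ by $T_xL_\Lambda=\sigma(L_\Lambda x)^{-1}\,\tilde\Lambda(x)\,\sigma(x)$ in coordinates. Then $\tilde\Lambda(O)=\Lambda$, and: 1. If $W\subseteq U$ is connected, $O\in W$ and $L_\Lambda(W)\subseteq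 U$, then $\tilde\Lambda(x)\in SO^+(p,q)$ for all $x\in W$. (In particular this holds for all $x\in U$ if $U$ is connected and stable under $G$.) 2. $(\Lambda_1\Lambda_2)^{\sim}(x)=\tilde\Lambda_1(L_{\Lambda_2}x)\,\tilde\Lambda_2(x)$ for all $\Lambda_1,\Lambda_2\in G$ and all $x\in U$ such that $L_{\Lambda_2}x\in U$ and $L_{\Lambda_1\Lambda_2}x\in U$. Moreover, the form $\omega_\mu(x)=\sum_{\nu=1}^n[\sigma(x)^{-1}]_{\nu\mu}\,B_\nu(x)$ satisfies $$\omega_\mu(L_\Lambda x)=\sum_{\nu=1}^n[\tilde\Lambda(x)^{-1}]_{\nu\mu}\,Ad(\Lambda)(\omega_\nu(x))$$ for all $\mu$, all $\Lambda\in G$ and all $x\in U$ with $L_\Lambda x\in U$. -/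

import Mathlib

open scoped Manifold ContDiff Matrix RightActions

noncomputable section

namespace EquivConn

/-! ### Matrices: `I_{p,q}` and `SO⁺(p,q)` -/

/-- `ℝ^{p+q}`, the first `p` indices being the positive directions. -/
abbrev Vec (p q : ℕ) : Type := Fin p ⊕ Fin q → ℝ

/-- `ℝ^{p+q}` is a manifold modelled on itself in the tautological way. -/
instance (priority := 10000) instChartedSpaceVec (p q : ℕ) : ChartedSpace (Vec p q) (Vec p q) :=
  chartedSpaceSelf (Vec p q)

/-- Square matrices of size `p + q`. -/
abbrev Mat (p q : ℕ) : Type := Matrix (Fin p ⊕ Fin q) (Fin p ⊕ Fin q) ℝ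

/-- `I_{p,q} = diag(1, …, 1, -1, …, -1)`. -/
abbrev Ipq (p q : ℕ) : Mat p q := LieAlgebra.Orthogonal.indefiniteDiagonal (Fin p) (Fin q) ℝ

/-- Membership in `SO⁺(p,q)`: the matrix preserves `I_{p,q}`, has determinant one, and its upper left
`p × p` block has positive determinant. -/
def IsSOPlus {p q : ℕ} (A : Mat p q) : Prop :=
  Aᵀ * Ipq p q * A = Ipq p q ∧ A.det = 1 ∧ 0 < A.toBlocks₁₁.det

/-! ### Semi-Riemannian manifolds, charts and tetrads -/

section Base

variable (p q : ℕ) (M : Type*) [TopologicalSpace M] [ChartedSpace (Vec p q) M]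
  [IsManifold 𝓘(ℝ, Vec p q) ∞ M]

/-- A smooth semi-Riemannian metric of signature `(p,q)` on a manifold of dimension `p + q`. -/
structure SemiRiemannianMetric where
  /-- The scalar product on each tangent space. -/
  inner (x : M) : TangentSpace 𝓘(ℝ, Vec p q) x →L[ℝ] TangentSpace 𝓘(ℝ, Vec p q) x →L[ℝ] ℝ
  symm (x : M) (v w : TangentSpace 𝓘(ℝ, Vec p q) x) : inner x v w = inner x w v
  signature (x : M) : ∃ b : Module.Basis (Fin p ⊕ Fin q) ℝ (TangentSpace 𝓘(ℝ, Vec p q) x),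
    ∀ i j, inner x (b i) (b j) = Ipq p q i j
  contMDiff : ContMDiff 𝓘(ℝ, Vec p q)
    (𝓘(ℝ, Vec p q).prod 𝓘(ℝ, Vec p q →L[ℝ] Vec p q →L[ℝ] ℝ)) ∞
    (fun x ↦ Bundle.TotalSpace.mk' (Vec p q →L[ℝ] Vec p q →L[ℝ] ℝ)
      (E := fun x : M ↦ TangentSpace 𝓘(ℝ, Vec p q) x →L[ℝ] TangentSpace 𝓘(ℝ, Vec p q) x →L[ℝ] ℝ)
      x (inner x))

variable {p q M}

/-- The components `dφ_x(v)` of a tangent vector `v` in the chart `φ`. -/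
def coords (φ : OpenPartialHomeomorph M (Vec p q)) (x : M)
    (v : TangentSpace 𝓘(ℝ, Vec p q) x) : Vec p q :=
  mfderiv 𝓘(ℝ, Vec p q) 𝓘(ℝ, Vec p q) φ x v

/-- The coordinate vector `∂_μ` at `x`: the tangent vector with `dφ_x(∂_μ) = e_μ`. -/
def coordVector (φ : OpenPartialHomeomorph M (Vec p q)) (x : M) (μ : Fin p ⊕ Fin q) :
    TangentSpace 𝓘(ℝ, Vec p q) x :=
  (mfderiv 𝓘(ℝ, Vec p q) 𝓘(ℝ, Vec p q) φ x).inverse (Pi.single μ (1 : ℝ) : Vec p q)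

/-- The Jacobian matrix at `x` of a map `f : M → M` in the chart `φ`: the matrix of `T_x f` with
respect to the coordinate vectors at `x` and at `f x`. -/
def jacobian (φ : OpenPartialHomeomorph M (Vec p q)) (f : M → M) (x : M) : Mat p q :=
  LinearMap.toMatrix' (fderiv ℝ (φ ∘ f ∘ φ.symm) (φ x) : Vec p q →ₗ[ℝ] Vec p q)

/-- The Jacobian matrix at `x` of the components of a vector field `ξ` in the chart `φ`. -/
def vectorFieldJacobian (φ : OpenPartialHomeomorph M (Vec p q))
    (ξ : ∀ x : M, TangentSpace 𝓘(ℝ, Vec p q) x) (x : M) : Mat p q :=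
  LinearMap.toMatrix'
    (fderiv ℝ (fun y ↦ coords φ (φ.symm y) (ξ (φ.symm y))) (φ x) : Vec p q →ₗ[ℝ] Vec p q)

/-- Smooth tetrads for `g` on the domain of the chart `φ`: in coordinates `g = σᵀ I_{p,q} σ`. -/
structure IsTetrad (g : SemiRiemannianMetric p q M) (φ : OpenPartialHomeomorph M (Vec p q))
    (σ : M → Mat p q) : Prop where
  smooth : ∀ i j, ContMDiffOn 𝓘(ℝ, Vec p q) 𝓘(ℝ, ℝ) ∞ (fun x ↦ σ x i j) φ.source
  metric_eq : ∀ x ∈ φ.source, ∀ v w : TangentSpace 𝓘(ℝ, Vec p q) x,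
    g.inner x v w = coords φ x v ⬝ᵥ (((σ x)ᵀ * Ipq p q * σ x) *ᵥ coords φ x w)

/-! ### Isometries fixing a point, Killing fields, and the group `K_O` with its action -/

/-- `f` is a diffeomorphism of `M` with `f(O) = O` that preserves the metric. -/
structure IsIsometryFixing (g : SemiRiemannianMetric p q M) (O : M) (f : Equiv.Perm M) : Prop where
  smooth : ContMDiff 𝓘(ℝ, Vec p q) 𝓘(ℝ, Vec p q) ∞ f
  smooth_symm : ContMDiff 𝓘(ℝ, Vec p q) 𝓘(ℝ, Vec p q) ∞ f.symm
  fixes : f O = O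
  isometry : ∀ (x : M) (v w : TangentSpace 𝓘(ℝ, Vec p q) x),
    g.inner (f x) (mfderiv 𝓘(ℝ, Vec p q) 𝓘(ℝ, Vec p q) f x v)
      (mfderiv 𝓘(ℝ, Vec p q) 𝓘(ℝ, Vec p q) f x w) = g.inner x v w

/-- `ξ ∈ 𝔨_O` with flow `Fl`: `ξ` is a smooth vector field whose flow is defined for all times and
consists of isometries of `M` fixing `O`. (As a flow starts at the identity, its members preserve
space and time orientations without further ado.) -/
structure IsKillingFlow (g : SemiRiemannianMetric p q M) (O : M)
    (ξ : ∀ x : M, TangentSpace 𝓘(ℝ, Vec p q) x) (Fl : ℝ → Equiv.Perm M) : Prop where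
  smooth : ContMDiff 𝓘(ℝ, Vec p q) 𝓘(ℝ, Vec p q).tangent ∞
    (fun x ↦ (⟨x, ξ x⟩ : TangentBundle 𝓘(ℝ, Vec p q) M))
  flow_zero : Fl 0 = 1
  flow : ∀ x, IsMIntegralCurve (I := 𝓘(ℝ, Vec p q)) (fun t ↦ Fl t x) ξ
  isometry : ∀ t, IsIsometryFixing g O (Fl t)

/-- The exponential `ψ_O(ξ) = σ(O) exp(-Jac_O ξ) σ(O)⁻¹`. -/
def psi (φ : OpenPartialHomeomorph M (Vec p q)) (σ : M → Mat p q) (O : M)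
    (ξ : ∀ x : M, TangentSpace 𝓘(ℝ, Vec p q) x) : Mat p q :=
  σ O * NormedSpace.exp (-(vectorFieldJacobian φ ξ O)) * (σ O)⁻¹

/-- The graph of the left action `Λ ↦ L_Λ` of `K_O` on `M`: the group generated by the pairs
`(ψ_O(ξ), (Fl_1^ξ)⁻¹)`, `ξ ∈ 𝔨_O`. In other words `R_Λ = Fl_1^ξ` for `Λ = ψ_O(ξ)`, where
`R_Λ = L_{Λ⁻¹}`, and this is extended multiplicatively. -/
def actionGraph (g : SemiRiemannianMetric p q M) (φ : OpenPartialHomeomorph M (Vec p q))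
    (σ : M → Mat p q) (O : M) : Subgroup (GL (Fin p ⊕ Fin q) ℝ × Equiv.Perm M) :=
  Subgroup.closure {a | ∃ ξ Fl, IsKillingFlow g O ξ Fl ∧
    (a.1 : Mat p q) = psi φ σ O ξ ∧ a.2 = (Fl 1)⁻¹}

/-- The special orthonormal orthochronous group `K_O` of `g`: the group generated by the
exponentials `ψ_O(ξ)`, `ξ ∈ 𝔨_O`. -/
def KO (g : SemiRiemannianMetric p q M) (φ : OpenPartialHomeomorph M (Vec p q))
    (σ : M → Mat p q) (O : M) : Subgroup (GL (Fin p ⊕ Fin q) ℝ) :=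
  (actionGraph g φ σ O).map (MonoidHom.fst _ _)

theorem exists_mem_actionGraph {g : SemiRiemannianMetric p q M}
    {φ : OpenPartialHomeomorph M (Vec p q)} {σ : M → Mat p q} {O : M} (Λ : KO g φ σ O) :
    ∃ f : Equiv.Perm M, ((Λ : GL (Fin p ⊕ Fin q) ℝ), f) ∈ actionGraph g φ σ O := by
  obtain ⟨a, ha, h⟩ := Subgroup.mem_map.1 Λ.2
  exact ⟨a.2, by rw [← h]; exact ha⟩

/-- The left action `L_Λ` of `Λ ∈ K_O` on `M`: the map `f` with `(Λ, f)` in the action graph. (It is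
unique when `M` is connected, as an isometry fixing `O` is determined by its differential at `O`.) -/
def leftAct {g : SemiRiemannianMetric p q M} {φ : OpenPartialHomeomorph M (Vec p q)}
    {σ : M → Mat p q} {O : M} (Λ : KO g φ σ O) : Equiv.Perm M :=
  (exists_mem_actionGraph Λ).choose

/-- The right action `R_Λ = L_{Λ⁻¹}` of `Λ ∈ K_O` on `M`. -/
def rightAct {g : SemiRiemannianMetric p q M} {φ : OpenPartialHomeomorph M (Vec p q)}
    {σ : M → Mat p q} {O : M} (Λ : KO g φ σ O) : Equiv.Perm M :=
  leftAct Λ⁻¹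

/-- `Λ̃(x)`, given by `T_x L_Λ = σ(L_Λ x)⁻¹ Λ̃(x) σ(x)` in coordinates. -/
def tilde {g : SemiRiemannianMetric p q M} {φ : OpenPartialHomeomorph M (Vec p q)}
    {σ : M → Mat p q} {O : M} (Λ : KO g φ σ O) (x : M) : Mat p q :=
  σ (leftAct Λ x) * jacobian φ (leftAct Λ) x * (σ x)⁻¹

end Base

/-! ### Lie groups, principal bundles and connections -/

section Bundle

variable {EG : Type*} [NormedAddCommGroup EG] [NormedSpace ℝ EG]
  {G : Type*} [Group G] [TopologicalSpace G] [ChartedSpace EG G]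

/-- `Ad(a)`, the differential at the identity of `h ↦ a h a⁻¹`. -/
def Ad (a : G) : GroupLieAlgebra 𝓘(ℝ, EG) G →L[ℝ] GroupLieAlgebra 𝓘(ℝ, EG) G :=
  mfderiv 𝓘(ℝ, EG) 𝓘(ℝ, EG) (fun h : G ↦ a * h * a⁻¹) 1

/-- `G` is a Lie subgroup of the matrix group `K` via `ι`: the homomorphism `ι` is an injective
smooth immersion. -/
structure IsLieSubgroup {p q : ℕ} {K : Subgroup (GL (Fin p ⊕ Fin q) ℝ)} (ι : G →* K) : Prop where
  injective : Function.Injective ι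
  smooth : ∀ i j, ContMDiff 𝓘(ℝ, EG) 𝓘(ℝ, ℝ) ∞
    (fun a ↦ ((ι a : GL (Fin p ⊕ Fin q) ℝ) : Mat p q) i j)
  immersion : ∀ X : GroupLieAlgebra 𝓘(ℝ, EG) G,
    (∀ i j, mfderiv 𝓘(ℝ, EG) 𝓘(ℝ, ℝ)
      (fun a ↦ ((ι a : GL (Fin p ⊕ Fin q) ℝ) : Mat p q) i j) 1 X = 0) → X = 0

variable {EM : Type*} [NormedAddCommGroup EM] [NormedSpace ℝ EM]
  {M : Type*} [TopologicalSpace M] [ChartedSpace EM M]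
  {EP : Type*} [NormedAddCommGroup EP] [NormedSpace ℝ EP]
  {P : Type*} [TopologicalSpace P] [ChartedSpace EP P] [MulAction Gᵐᵒᵖ P]

/-- `π : P → M` is a principal fibre bundle for the right action `u <• a` of `G` on `P`. -/
structure IsPrincipalBundle (EG G EM EP) [NormedAddCommGroup EG] [NormedSpace ℝ EG] [Group G]
    [TopologicalSpace G] [ChartedSpace EG G] [NormedAddCommGroup EM] [NormedSpace ℝ EM]
    {M : Type*} [TopologicalSpace M] [ChartedSpace EM M]
    [NormedAddCommGroup EP] [NormedSpace ℝ EP]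
    {P : Type*} [TopologicalSpace P] [ChartedSpace EP P] [MulAction Gᵐᵒᵖ P]
    (π : P → M) : Prop where
  smooth_proj : ContMDiff 𝓘(ℝ, EP) 𝓘(ℝ, EM) ∞ π
  smooth_act : ∀ a : G, ContMDiff 𝓘(ℝ, EP) 𝓘(ℝ, EP) ∞ (fun u : P ↦ u <• a)
  proj_act : ∀ (u : P) (a : G), π (u <• a) = π u
  free : ∀ (u : P) (a : G), u <• a = u → a = 1
  transitive : ∀ u v : P, π u = π v → ∃ a : G, u <• a = v
  bundle_chart : ∀ x : M, ∃ e : OpenPartialHomeomorph P (M × G), ∃ W : Set M,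
    IsOpen W ∧ x ∈ W ∧ e.source = π ⁻¹' W ∧ e.target = W ×ˢ Set.univ ∧
    ContMDiffOn 𝓘(ℝ, EP) (𝓘(ℝ, EM).prod 𝓘(ℝ, EG)) ∞ e e.source ∧
    ContMDiffOn (𝓘(ℝ, EM).prod 𝓘(ℝ, EG)) 𝓘(ℝ, EP) ∞ e.symm e.target ∧
    ∀ u ∈ e.source, (e u).1 = π u ∧ ∀ a : G, e (u <• a) = ((e u).1, (e u).2 * a)

/-- A connection `1`-form on `P`: a smooth `𝔤`-valued `1`-form `A` with
`A_{u·a} ∘ T_u R_a = Ad(a⁻¹) ∘ A_u` and `A(X̃) = X` for the fundamental vector fields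
`X̃(u) = d/dt|_{t=0} u·exp(tX)`, i.e. the image of `X` under the differential at `1` of `a ↦ u·a`. -/
structure ConnectionForm (EG G EP P) [NormedAddCommGroup EG] [NormedSpace ℝ EG] [Group G]
    [TopologicalSpace G] [ChartedSpace EG G] [NormedAddCommGroup EP] [NormedSpace ℝ EP]
    [TopologicalSpace P] [ChartedSpace EP P] [IsManifold 𝓘(ℝ, EP) ∞ P] [MulAction Gᵐᵒᵖ P] where
  /-- The values of the form. -/
  form (u : P) : TangentSpace 𝓘(ℝ, EP) u →L[ℝ] GroupLieAlgebra 𝓘(ℝ, EG) G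
  smooth : ContMDiff 𝓘(ℝ, EP) (𝓘(ℝ, EP).prod 𝓘(ℝ, EP →L[ℝ] EG)) ∞
    (fun u ↦ Bundle.TotalSpace.mk' (EP →L[ℝ] EG)
      (E := fun u : P ↦ TangentSpace 𝓘(ℝ, EP) u →L[ℝ] Bundle.Trivial P EG u) u (form u))
  equivariant (u : P) (a : G) :
    (form (u <• a)).comp (mfderiv 𝓘(ℝ, EP) 𝓘(ℝ, EP) (fun v : P ↦ v <• a) u) =
      (Ad (EG := EG) a⁻¹).comp (form u)
  vertical (u : P) (X : GroupLieAlgebra 𝓘(ℝ, EG) G) :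
    form (u <• (1 : G)) (mfderiv 𝓘(ℝ, EG) 𝓘(ℝ, EP) (fun a : G ↦ u <• a) 1 X) = X

/-- The local form `A^s = A_{s(x)} ∘ T_x s` of a connection form `A` along a map `s` to `P`. -/
def ConnectionForm.localForm [IsManifold 𝓘(ℝ, EP) ∞ P] (A : ConnectionForm EG G EP P)
    (s : M → P) (x : M) : TangentSpace 𝓘(ℝ, EM) x →L[ℝ] GroupLieAlgebra 𝓘(ℝ, EG) G :=
  (A.form (s x)).comp (mfderiv 𝓘(ℝ, EM) 𝓘(ℝ, EP) s x)

/-- `s` is an adapted equivariant section of `A` on `U`, for a right action `r` of `G` on the base: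
`A^{R_a ∘ s} = A^{s ∘ r_a}` for all `a`, wherever both sides are defined. -/
def IsAdaptedEquivariant (EM) [NormedAddCommGroup EM] [NormedSpace ℝ EM] [ChartedSpace EM M]
    [IsManifold 𝓘(ℝ, EP) ∞ P] (A : ConnectionForm EG G EP P)
    (r : G → M → M) (s : M → P) (U : Set M) : Prop :=
  ∀ (a : G), ∀ x ∈ U, r a x ∈ U →
    A.localForm (EM := EM) (fun y ↦ s y <• a) x = A.localForm (EM := EM) (s ∘ r a) x

/-- The tetrad-weighted components `ω_μ(x) = ∑_ν [σ(x)⁻¹]_{νμ} B_ν(x)`, with `B_ν = B(∂_ν)`. -/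
def omega {p q : ℕ} {N : Type*} [TopologicalSpace N] [ChartedSpace (Vec p q) N]
    (φ : OpenPartialHomeomorph N (Vec p q)) (σ : N → Mat p q)
    (B : ∀ x : N, TangentSpace 𝓘(ℝ, Vec p q) x →L[ℝ] GroupLieAlgebra 𝓘(ℝ, EG) G)
    (μ : Fin p ⊕ Fin q) (x : N) : GroupLieAlgebra 𝓘(ℝ, EG) G :=
  ∑ ν, (σ x)⁻¹ ν μ • B x (coordVector φ x ν)

end Bundle

end EquivConn

end

/-!
Everything rests on two facts about a connected semi-Riemannian manifold `M` with a base point `O`.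

*The differential of a flow at a fixed point.* If `ξ ∈ 𝔨_O`, then `T_O Fl_t^ξ = exp(t Jac_O ξ)` in
the chart (`IsKillingFlow.jacobian_flow`). No smooth dependence on initial values is needed: near
the zero of `ξ` the field differs from its linearization by `o(|y|)`, so Grönwall's inequality compares
the flow line through `h` with `exp(t Jac_O ξ) h` up to `o(|h|)` (`norm_sub_exp_le`,
`exists_integralCurve_estimate`). Hence every pair `(Λ, f)` in the action graph satisfies
`Λ = σ(O) (T_O f) σ(O)⁻¹`, and `Λ` lies in `SO⁺(p,q)`, since `t ↦ T_O Fl_t` joins each generator to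
the identity inside `O(p,q)`, where `det A` and `det A₁₁` do not vanish (`mem_actionGraph`).

*Rigidity.* An isometry fixing `O` with differential the identity at `O` is the identity
(`IsIsometryFixing.eq_one`). Geodesics are avoided. Differentiating the isometry equation and
permuting indices as in Koszul's formula expresses `f''` through `f'`, `f` and the metric, and the
expression vanishes on the `1`-jet of the identity; so `|f''| ≤ C (|f - id| + |f' - 1|)`
(`exists_norm_secondDeriv_le`), and Grönwall's inequality along rays gives `f = id` locally
(`eventually_eq_self_of_isometry`). The set where `f` is locally the identity is open and closed.
Consequently an element of the action graph is determined by its matrix, and `Λ ↦ L_Λ` is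
multiplicative (`leftAct_mul`); with the chain rule this is the cocycle rule for `Λ̃`.

The matrix `Λ̃(x)` is the differential of an isometry in the tetrad frames, hence pseudo-orthogonal;
it is `Λ` at `O` and continuous in `x`, so it stays in `SO⁺(p,q)` on connected sets
(`isSOPlus_tilde`). The equivariance of the section for `Λ⁻¹`, together with `R_a^* A = Ad(a⁻¹) A`,
is the equivariance of the local form (`localForm_leftAct`), from which that of the
tetrad-weighted components follows by linear algebra (`omega_leftAct`).
-/

noncomputable section

namespace EquivConn

open Set Filter Topology

/-! ### The pseudo-orthogonal group and its component `SO⁺(p,q)` -/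

section Matrices

variable {p q : ℕ}

/-- Membership in `O(p,q)`: the matrix preserves `I_{p,q}`. -/
def IsPseudoOrthogonal (A : Mat p q) : Prop :=
  Aᵀ * Ipq p q * A = Ipq p q

theorem Ipq_mul_self : Ipq p q * Ipq p q = 1 := by
  rw [Ipq, LieAlgebra.Orthogonal.indefiniteDiagonal, Matrix.diagonal_mul_diagonal,
    ← Matrix.diagonal_one]
  congr 1
  ext i
  cases i <;> simp

theorem Ipq_apply_self_ne_zero (j : Fin p ⊕ Fin q) : Ipq p q j j ≠ 0 := by
  rcases j with j | j <;> simp [LieAlgebra.Orthogonal.indefiniteDiagonal]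

theorem Ipq_det_ne_zero : (Ipq p q).det ≠ 0 := by
  intro h
  simpa [h] using congrArg Matrix.det (Ipq_mul_self (p := p) (q := q))

theorem IsPseudoOrthogonal.det_sq {A : Mat p q} (hA : IsPseudoOrthogonal A) :
    A.det * A.det = 1 := by
  have h : A.det * (Ipq p q).det * A.det = (Ipq p q).det := by
    simpa using congrArg Matrix.det hA
  have : (A.det * A.det) * (Ipq p q).det = 1 * (Ipq p q).det := by linarith
  exact mul_right_cancel₀ Ipq_det_ne_zero this

theorem IsPseudoOrthogonal.mul {A B : Mat p q} (hA : IsPseudoOrthogonal A)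
    (hB : IsPseudoOrthogonal B) : IsPseudoOrthogonal (A * B) := by
  unfold IsPseudoOrthogonal at *
  rw [Matrix.transpose_mul, show Bᵀ * Aᵀ * Ipq p q * (A * B) = Bᵀ * (Aᵀ * Ipq p q * A) * B by
    simp only [Matrix.mul_assoc], hA, hB]

theorem Ipq_eq_fromBlocks : Ipq p q = Matrix.fromBlocks 1 0 0 (-1) := by
  ext i j
  rcases i with i | i <;> rcases j with j | j <;>
    simp [LieAlgebra.Orthogonal.indefiniteDiagonal, Matrix.diagonal_apply, Matrix.one_apply]
  split_ifs <;> simp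

/-- On a vector `v` in the kernel of the upper left block, the relation `Aᵀ I A = I` reads
`-|A₂₁ v|² = |v|²`. -/
theorem IsPseudoOrthogonal.det_toBlocks₁₁_ne_zero {A : Mat p q} (hA : IsPseudoOrthogonal A) :
    A.toBlocks₁₁.det ≠ 0 := by
  intro h
  obtain ⟨v, hv, hAv⟩ := Matrix.exists_mulVec_eq_zero_iff.2 h
  have h11 : A.toBlocks₁₁ᵀ * A.toBlocks₁₁ - A.toBlocks₂₁ᵀ * A.toBlocks₂₁ = 1 := by
    have := hA
    unfold IsPseudoOrthogonal at this
    rw [← Matrix.fromBlocks_toBlocks A, Ipq_eq_fromBlocks, Matrix.fromBlocks_transpose,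
      Matrix.fromBlocks_multiply, Matrix.fromBlocks_multiply] at this
    have := (Matrix.fromBlocks_inj.1 this).1
    simpa [sub_eq_add_neg] using this
  have h1 : -((A.toBlocks₂₁ *ᵥ v) ⬝ᵥ (A.toBlocks₂₁ *ᵥ v)) = v ⬝ᵥ v := by
    have := congrArg (fun N ↦ v ⬝ᵥ (N *ᵥ v)) h11
    simp only [Matrix.sub_mulVec, ← Matrix.mulVec_mulVec, hAv, Matrix.mulVec_zero, zero_sub,
      Matrix.one_mulVec, dotProduct_neg] at this
    rw [← this, Matrix.dotProduct_mulVec v, Matrix.vecMul_transpose]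
  have h2 : 0 ≤ (A.toBlocks₂₁ *ᵥ v) ⬝ᵥ (A.toBlocks₂₁ *ᵥ v) := by
    simpa using dotProduct_star_self_nonneg (A.toBlocks₂₁ *ᵥ v)
  have h3 : 0 ≤ v ⬝ᵥ v := by simpa using dotProduct_star_self_nonneg v
  exact hv (dotProduct_self_eq_zero.1 (by linarith))

/-- A nowhere vanishing continuous function on a preconnected set has constant sign. -/
theorem pos_of_isPreconnected {X : Type*} [TopologicalSpace X] {S : Set X} (hS : IsPreconnected S)
    {f : X → ℝ} (hf : ContinuousOn f S) (h0 : ∀ x ∈ S, f x ≠ 0) {a b : X} (ha : a ∈ S) (hb : b ∈ S)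
    (hfa : 0 < f a) : 0 < f b := by
  by_contra! hfb
  obtain ⟨c, hc, hc0⟩ := hS.intermediate_value hb ha hf ⟨hfb, hfa.le⟩
  exact h0 c hc hc0

/-- Both signs that cut `SO⁺(p,q)` out of `O(p,q)` are locally constant. -/
theorem IsSOPlus.of_isPreconnected {X : Type*} [TopologicalSpace X] {S : Set X}
    (hS : IsPreconnected S) {F : X → Mat p q} (hF : ContinuousOn F S)
    (hO : ∀ x ∈ S, IsPseudoOrthogonal (F x)) {a b : X} (ha : a ∈ S) (hb : b ∈ S)
    (hFa : IsSOPlus (F a)) : IsSOPlus (F b) := by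
  refine ⟨hO b hb, ?_, ?_⟩
  · have hpos : 0 < (F b).det := by
      refine pos_of_isPreconnected (f := fun x ↦ (F x).det) hS ?_ ?_ ha hb ?_
      · exact (Continuous.matrix_det continuous_id).comp_continuousOn hF
      · intro x hx h
        simpa [h] using (hO x hx).det_sq
      · simp [hFa.2.1]
    have := (hO b hb).det_sq
    rcases mul_self_eq_one_iff.1 this with h | h
    · exact h
    · linarith
  · refine pos_of_isPreconnected (f := fun x ↦ (F x).toBlocks₁₁.det) hS ?_
      (fun x hx ↦ (hO x hx).det_toBlocks₁₁_ne_zero) ha hb hFa.2.2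
    have : Continuous fun A : Mat p q ↦ A.toBlocks₁₁.det := by
      refine Continuous.matrix_det ?_
      exact continuous_matrix fun i j ↦ continuous_id.matrix_elem _ _
    exact this.comp_continuousOn hF

theorem isSOPlus_one : IsSOPlus (1 : Mat p q) := by
  refine ⟨by simp, by simp, ?_⟩
  rw [← Matrix.fromBlocks_one, Matrix.toBlocks_fromBlocks₁₁]
  simp

end Matrices

/-! ### Infinitesimal rigidity of isometries in a vector space -/

section Rigidity

/-- The Koszul permutation: if `S` is symmetric in its first two arguments and
`R(v,w,u) = S(v,w,u) + S(v,u,w)`, then `S` is determined by `R`. -/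
theorem two_mul_eq_of_symmetrization {E : Type*} {S R : E → E → E → ℝ}
    (hS : ∀ v w u, S v w u = S w v u)
    (hR : ∀ v w u, S v w u + S v u w = R v w u) (v w u : E) :
    2 * S v w u = R v w u + R w v u - R u v w := by
  have h1 := hR v w u
  have h2 := hR w v u
  have h3 := hR u v w
  rw [hS w v u, hS w u v] at h2
  rw [hS u v w] at h3
  linarith

set_option maxSynthPendingDepth 3

variable {E : Type*} [NormedAddCommGroup E] [NormedSpace ℝ E]

/-- For `z = (y, A)`, the trilinear form `(v, w, u) ↦ (∂_{Av} G)_y (A w, A u)`. -/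
def pullbackDeriv (G : E → E →L[ℝ] E →L[ℝ] ℝ) (z : E × (E →L[ℝ] E)) :
    E →L[ℝ] E →L[ℝ] E →L[ℝ] ℝ :=
  (ContinuousLinearMap.compL ℝ E (E →L[ℝ] ℝ) (E →L[ℝ] ℝ)
      ((ContinuousLinearMap.compL ℝ E E ℝ).flip z.2)).comp
    (((ContinuousLinearMap.compL ℝ E E (E →L[ℝ] ℝ)).flip z.2).comp ((fderiv ℝ G z.1).comp z.2))

@[simp] theorem pullbackDeriv_apply (G : E → E →L[ℝ] E →L[ℝ] ℝ) (z : E × (E →L[ℝ] E)) (v w u : E) :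
    pullbackDeriv G z v w u = fderiv ℝ G z.1 (z.2 v) (z.2 w) (z.2 u) := rfl

theorem contDiffAt_pullbackDeriv {G : E → E →L[ℝ] E →L[ℝ] ℝ} {x₀ : E} (hG : ContDiffAt ℝ 2 G x₀)
    (A : E →L[ℝ] E) : ContDiffAt ℝ 1 (pullbackDeriv G) (x₀, A) := by
  have h1 : ContDiffAt ℝ 1 (fun z : E × (E →L[ℝ] E) ↦ fderiv ℝ G z.1) (x₀, A) :=
    ContDiffAt.comp (x₀, A) (g := fderiv ℝ G) (hG.fderiv_right (m := 1) (by norm_num))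
      contDiffAt_fst
  have h2 : ContDiffAt ℝ 1 (fun z : E × (E →L[ℝ] E) ↦ z.2) (x₀, A) := contDiffAt_snd
  unfold pullbackDeriv
  refine ContDiffAt.clm_comp ?_ (ContDiffAt.clm_comp ?_ (h1.clm_comp h2))
  · exact (ContinuousLinearMap.contDiff _).contDiffAt.comp _
      ((ContinuousLinearMap.contDiff _).contDiffAt.comp _ h2)
  · exact (ContinuousLinearMap.contDiff _).contDiffAt.comp _ h2

/-- The derivative of the isometry equation `G_{f(x)}(f'w, f'u) = G_x(w, u)`. -/
theorem secondDeriv_isometry {G : E → E →L[ℝ] E →L[ℝ] ℝ} {f : E → E} {x : E}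
    (hGx : DifferentiableAt ℝ G x) (hGf : DifferentiableAt ℝ G (f x)) (hf : ContDiffAt ℝ 2 f x)
    (hiso : ∀ᶠ y in 𝓝 x, ∀ w u, G (f y) (fderiv ℝ f y w) (fderiv ℝ f y u) = G y w u) (v w u : E) :
    G (f x) (fderiv ℝ (fderiv ℝ f) x v w) (fderiv ℝ f x u) +
      G (f x) (fderiv ℝ f x w) (fderiv ℝ (fderiv ℝ f) x v u) =
    pullbackDeriv G (x, 1) v w u - pullbackDeriv G (f x, fderiv ℝ f x) v w u := by
  have hf1 : HasFDerivAt f (fderiv ℝ f x) x := (hf.differentiableAt (by norm_num)).hasFDerivAt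
  have hf2 : HasFDerivAt (fderiv ℝ f) (fderiv ℝ (fderiv ℝ f) x) x :=
    ((hf.fderiv_right (m := 1) (by norm_num)).differentiableAt (by norm_num)).hasFDerivAt
  have hG1 : HasFDerivAt (fun y ↦ G (f y)) ((fderiv ℝ G (f x)).comp (fderiv ℝ f x)) x :=
    HasFDerivAt.comp (g := G) x hGf.hasFDerivAt hf1
  have hw := hf2.clm_apply (hasFDerivAt_const w x)
  have hu := hf2.clm_apply (hasFDerivAt_const u x)
  have hL := (hG1.clm_apply hw).clm_apply hu
  have hR := (hGx.hasFDerivAt.clm_apply (hasFDerivAt_const w x)).clm_apply (hasFDerivAt_const u x)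
  have heq := (hL.congr_of_eventuallyEq (f₁ := fun y ↦ G y w u)
    (hiso.mono fun y hy ↦ (hy w u).symm)).unique hR
  have := congrArg (fun T : E →L[ℝ] ℝ ↦ T v) heq
  simp at this
  simp
  linarith

/-- In finite dimension, injective operators are bounded below, locally uniformly. -/
theorem exists_norm_le_mul_norm_clm_of_injective [FiniteDimensional ℝ E] {F : Type*}
    [NormedAddCommGroup F] [NormedSpace ℝ F] (L₀ : E →L[ℝ] F) (h : Function.Injective L₀) :
    ∃ C > 0, ∀ᶠ L in 𝓝 L₀, ∀ a, ‖a‖ ≤ C * ‖L a‖ := by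
  obtain ⟨K, hK, hanti⟩ := LinearMap.exists_antilipschitzWith (L₀ : E →ₗ[ℝ] F)
    (LinearMap.ker_eq_bot.2 h)
  have hK' : (0 : ℝ) < K := hK
  refine ⟨2 * K, by positivity, ?_⟩
  filter_upwards [Metric.ball_mem_nhds L₀ (show (0 : ℝ) < 1 / (2 * K) by positivity)] with L hL a
  have h1 : ‖a‖ ≤ K * ‖L₀ a‖ := by
    simpa [dist_eq_norm] using hanti.le_mul_dist a 0
  have h2 : ‖L₀ a‖ ≤ ‖L a‖ + 1 / (2 * K) * ‖a‖ := by
    have h3 : ‖(L - L₀) a‖ ≤ 1 / (2 * K) * ‖a‖ :=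
      ((L - L₀).le_opNorm a).trans
        (mul_le_mul_of_nonneg_right (mem_ball_iff_norm.1 hL).le (norm_nonneg _))
    calc ‖L₀ a‖ = ‖L a - (L - L₀) a‖ := by simp
      _ ≤ ‖L a‖ + ‖(L - L₀) a‖ := norm_sub_le _ _
      _ ≤ _ := by gcongr
  have h4 : K * ‖L₀ a‖ ≤ K * ‖L a‖ + ‖a‖ / 2 := by
    calc K * ‖L₀ a‖ ≤ K * (‖L a‖ + 1 / (2 * K) * ‖a‖) := by gcongr
      _ = _ := by field_simp
  linarith

/-- The second derivative of an isometry is controlled by the distance of its first jet from the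
jet of the identity. -/
theorem exists_norm_secondDeriv_le [FiniteDimensional ℝ E] {G : E → E →L[ℝ] E →L[ℝ] ℝ} {f : E → E}
    {x₀ : E} (hG : ContDiffAt ℝ 2 G x₀) (hsymm : ∀ᶠ y in 𝓝 x₀, ∀ v w, G y v w = G y w v)
    (hnd : Function.Injective (G x₀)) (hf : ContDiffAt ℝ 2 f x₀) (hfx : f x₀ = x₀)
    (hf' : fderiv ℝ f x₀ = 1)
    (hiso : ∀ᶠ y in 𝓝 x₀, ∀ w u, G (f y) (fderiv ℝ f y w) (fderiv ℝ f y u) = G y w u) :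
    ∃ C : ℝ, ∀ᶠ x in 𝓝 x₀, ‖fderiv ℝ (fderiv ℝ f) x‖ ≤ C * ‖(f x - x, fderiv ℝ f x - 1)‖ := by
  obtain ⟨K, t, ht, hlip⟩ := (contDiffAt_pullbackDeriv hG 1).exists_lipschitzOnWith
  have hfc : ContinuousAt f x₀ := hf.continuousAt
  have hf'c : ContinuousAt (fderiv ℝ f) x₀ :=
    (hf.fderiv_right (m := 1) (by norm_num)).continuousAt
  have hfc' : Tendsto f (𝓝 x₀) (𝓝 x₀) := by simpa [ContinuousAt, hfx] using hfc
  have htend1 : Tendsto (fun x ↦ (f x, fderiv ℝ f x)) (𝓝 x₀) (𝓝 (x₀, 1)) := by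
    have := hfc.prodMk hf'c
    rwa [ContinuousAt, hfx, hf'] at this
  have htend2 : Tendsto (fun x : E ↦ (x, (1 : E →L[ℝ] E))) (𝓝 x₀) (𝓝 (x₀, 1)) :=
    tendsto_id.prodMk_nhds tendsto_const_nhds
  -- the operators `a ↦ G_{f(x)}(a, f'(x) ·)` converge to the nondegenerate `G_{x₀}`
  let Q : E → E →L[ℝ] E →L[ℝ] ℝ := fun x ↦
    ((ContinuousLinearMap.compL ℝ E E ℝ).flip (fderiv ℝ f x)).comp (G (f x))
  have hQ : Tendsto Q (𝓝 x₀) (𝓝 (G x₀)) := by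
    have h1 : ContinuousAt Q x₀ := by
      refine ContinuousAt.clm_comp ?_ ?_
      · exact (ContinuousLinearMap.continuous _).continuousAt.comp hf'c
      · exact ContinuousAt.comp (by rw [hfx]; exact hG.continuousAt) hfc
    have h2 : Q x₀ = G x₀ := by
      ext a b
      simp [Q, hfx, hf']
    rwa [ContinuousAt, h2] at h1
  obtain ⟨C, hC, hCQ⟩ := exists_norm_le_mul_norm_clm_of_injective (G x₀) hnd
  have hdiff : ∀ᶠ y in 𝓝 x₀, DifferentiableAt ℝ G y :=
    (hG.eventually (by simp)).mono fun y hy ↦ hy.differentiableAt (by norm_num)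
  refine ⟨C * (3 / 2 * K), ?_⟩
  filter_upwards [htend1.eventually ht, htend2.eventually ht, hQ.eventually hCQ, hdiff,
    hfc'.eventually hdiff, hf.eventually (by simp), hiso.eventually_nhds, hfc'.eventually hsymm]
    with x hx1 hx2 hxQ hGx hGf hfx2 hisox hsy
  set N := ‖(f x - x, fderiv ℝ f x - 1)‖ with hN
  set D := fderiv ℝ (fderiv ℝ f) x with hD
  have hDs : ∀ v w, D v w = D w v := fun v w ↦ hfx2.isSymmSndFDerivAt (by simp) v w
  set R := pullbackDeriv G (x, 1) - pullbackDeriv G (f x, fderiv ℝ f x) with hR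
  have hRN : ‖R‖ ≤ K * N := by
    have := hlip.dist_le_mul _ hx2 _ hx1
    rw [dist_comm (x, (1 : E →L[ℝ] E)), dist_eq_norm, dist_eq_norm] at this
    simpa [hN] using this
  have hR3 : ∀ v w u, |R v w u| ≤ K * N * (‖v‖ * ‖w‖ * ‖u‖) := fun v w u ↦ by
    calc |R v w u| ≤ ‖R v‖ * ‖w‖ * ‖u‖ := (R v).le_opNorm₂ w u
      _ ≤ ‖R‖ * ‖v‖ * ‖w‖ * ‖u‖ := by gcongr; exact R.le_opNorm v
      _ = ‖R‖ * (‖v‖ * ‖w‖ * ‖u‖) := by ring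
      _ ≤ _ := by gcongr
  have hkey := two_mul_eq_of_symmetrization
    (S := fun v w u ↦ G (f x) (D v w) (fderiv ℝ f x u)) (R := fun v w u ↦ R v w u)
    (fun v w u ↦ by simp only [hDs v w])
    (fun v w u ↦ by
      have := secondDeriv_isometry hGx hGf hfx2 hisox v w u
      rw [hsy (fderiv ℝ f x w)] at this
      simpa [hR] using this)
  have hS : ∀ v w, ‖Q x (D v w)‖ ≤ 3 / 2 * (K * N) * (‖v‖ * ‖w‖) := fun v w ↦ by
    refine ContinuousLinearMap.opNorm_le_bound _ (by positivity) fun u ↦ ?_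
    have h0 : Q x (D v w) u = G (f x) (D v w) (fderiv ℝ f x u) := rfl
    have h1 := hkey v w u
    have e1 := abs_le.1 (hR3 v w u)
    have e2 := abs_le.1 (hR3 w v u)
    have e3 := abs_le.1 (hR3 u v w)
    have c2 : ‖w‖ * ‖v‖ * ‖u‖ = ‖v‖ * ‖w‖ * ‖u‖ := by ring
    have c3 : ‖u‖ * ‖v‖ * ‖w‖ = ‖v‖ * ‖w‖ * ‖u‖ := by ring
    rw [c2] at e2
    rw [c3] at e3
    rw [h0, Real.norm_eq_abs, abs_le]
    constructor <;> nlinarith [e1.1, e1.2, e2.1, e2.2, e3.1, e3.2]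
  refine ContinuousLinearMap.opNorm_le_bound₂ _ (by positivity) fun v w ↦ ?_
  calc ‖D v w‖ ≤ C * ‖Q x (D v w)‖ := hxQ _
    _ ≤ C * (3 / 2 * (K * N) * (‖v‖ * ‖w‖)) := by gcongr; exact hS v w
    _ = _ := by ring

/-- An isometry with the `1`-jet of the identity at a point is the identity nearby: along every ray,
the deviation of its `1`-jet from that of the identity satisfies a linear differential
inequality. -/
theorem eventually_eq_self_of_isometry [FiniteDimensional ℝ E] {G : E → E →L[ℝ] E →L[ℝ] ℝ}
    {f : E → E} {x₀ : E} (hG : ContDiffAt ℝ 2 G x₀)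
    (hsymm : ∀ᶠ y in 𝓝 x₀, ∀ v w, G y v w = G y w v)
    (hnd : Function.Injective (G x₀)) (hf : ContDiffAt ℝ 2 f x₀) (hfx : f x₀ = x₀)
    (hf' : fderiv ℝ f x₀ = 1)
    (hiso : ∀ᶠ y in 𝓝 x₀, ∀ w u, G (f y) (fderiv ℝ f y w) (fderiv ℝ f y u) = G y w u) :
    ∀ᶠ x in 𝓝 x₀, f x = x := by
  obtain ⟨C, hC⟩ := exists_norm_secondDeriv_le hG hsymm hnd hf hfx hf' hiso
  obtain ⟨r, hr, hball⟩ := Metric.eventually_nhds_iff_ball.1 (hC.and (hf.eventually (by simp)))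
  filter_upwards [Metric.ball_mem_nhds x₀ hr] with x hx
  set v := x - x₀ with hv
  have hvr : ‖v‖ < r := by simpa [dist_eq_norm] using hx
  have hmem : ∀ t ∈ Icc (0 : ℝ) 1, x₀ + t • v ∈ Metric.ball x₀ r := fun t ht ↦ by
    rw [Metric.mem_ball, dist_eq_norm, add_sub_cancel_left, norm_smul, Real.norm_eq_abs,
      abs_of_nonneg ht.1]
    nlinarith [ht.2, norm_nonneg v]
  let z : ℝ → E × (E →L[ℝ] E) := fun t ↦
    (f (x₀ + t • v) - (x₀ + t • v), fderiv ℝ f (x₀ + t • v) - 1)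
  let z' : ℝ → E × (E →L[ℝ] E) := fun t ↦
    (fderiv ℝ f (x₀ + t • v) v - v, fderiv ℝ (fderiv ℝ f) (x₀ + t • v) v)
  have hz : ∀ t ∈ Icc (0 : ℝ) 1, HasDerivAt z (z' t) t := fun t ht ↦ by
    have hc := (hball _ (hmem t ht)).2
    have hl : HasDerivAt (fun t : ℝ ↦ x₀ + t • v) v t := by
      simpa using ((hasDerivAt_id t).smul_const v).const_add x₀
    have h1 := (hc.differentiableAt (by norm_num)).hasFDerivAt.comp_hasDerivAt t hl
    have h2 := ((hc.fderiv_right (m := 1) (by norm_num)).differentiableAt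
      (by norm_num)).hasFDerivAt.comp_hasDerivAt t hl
    exact (h1.sub hl).prodMk (h2.sub_const 1)
  have hbound : ∀ t ∈ Icc (0 : ℝ) 1, ‖z' t‖ ≤ max ‖v‖ (C * ‖v‖) * ‖z t‖ := fun t ht ↦ by
    refine norm_prod_le_iff.2 ⟨?_, ?_⟩
    · calc ‖(z' t).1‖ = ‖(z t).2 v‖ := by simp [z, z']
        _ ≤ ‖(z t).2‖ * ‖v‖ := (z t).2.le_opNorm v
        _ ≤ ‖z t‖ * ‖v‖ := by gcongr; exact norm_snd_le _
        _ ≤ _ := by rw [mul_comm]; gcongr; exact le_max_left _ _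
    · calc ‖(z' t).2‖ ≤ ‖fderiv ℝ (fderiv ℝ f) (x₀ + t • v)‖ * ‖v‖ :=
            ContinuousLinearMap.le_opNorm _ _
        _ ≤ C * ‖z t‖ * ‖v‖ := by gcongr; exact (hball _ (hmem t ht)).1
        _ = C * ‖v‖ * ‖z t‖ := by ring
        _ ≤ _ := by gcongr; exact le_max_right _ _
  have h1 := eq_zero_of_abs_deriv_le_mul_abs_self_of_eq_zero_right (f := z) (f' := z')
    (fun t ht ↦ (hz t ht).continuousAt.continuousWithinAt)
    (fun t ht ↦ (hz t (Ico_subset_Icc_self ht)).hasDerivWithinAt)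
    (by simp [z, hfx, hf']) (fun t ht ↦ hbound t (Ico_subset_Icc_self ht)) 1 (by simp)
  have h2 : f (x₀ + (1 : ℝ) • v) - (x₀ + (1 : ℝ) • v) = 0 := congrArg Prod.fst h1
  simpa [hv, sub_eq_zero] using h2

end Rigidity

/-! ### The differential of a flow at a fixed point -/

section Flow

set_option maxSynthPendingDepth 3

/-- A solution of a differential equation whose right hand side is close to the linear field `J`
stays close to the solution of the linear equation. -/
theorem norm_sub_exp_le {E : Type*} [NormedAddCommGroup E] [NormedSpace ℝ E] [CompleteSpace E]
    {F : E → E} {J : E →L[ℝ] E} {ε r T : ℝ} (hε : ε ≤ 1) (hε0 : 0 ≤ ε)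
    (hF : ∀ y, ‖y‖ ≤ r → ‖F y - J y‖ ≤ ε * ‖y‖) (hT : T ≤ 1) {c : ℝ → E}
    (hc : ∀ t ∈ Icc 0 T, HasDerivAt c (F (c t)) t) (hcr : ∀ t ∈ Icc 0 T, ‖c t‖ ≤ r)
    {t : ℝ} (ht : t ∈ Icc 0 T) :
    ‖c t‖ ≤ ‖c 0‖ * Real.exp (‖J‖ + 1) ∧
      ‖c t - NormedSpace.exp (t • J) (c 0)‖ ≤
        ε * (Real.exp (‖J‖ + 1) * Real.exp (‖J‖ + 1)) * ‖c 0‖ := by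
  have hK : (0 : ℝ) < ‖J‖ + 1 := by positivity
  have hexp : ∀ s ∈ Icc (0 : ℝ) T, Real.exp ((‖J‖ + 1) * (s - 0)) ≤ Real.exp (‖J‖ + 1) :=
    fun s hs ↦ Real.exp_le_exp.2 (by nlinarith [hs.1, hs.2])
  have h1 : ∀ s ∈ Icc (0 : ℝ) T, ‖c s‖ ≤ ‖c 0‖ * Real.exp (‖J‖ + 1) := fun s hs ↦ by
    have := norm_le_gronwallBound_of_norm_deriv_right_le (f := c) (f' := fun t ↦ F (c t))
      (δ := ‖c 0‖) (K := ‖J‖ + 1) (ε := 0)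
      (fun t ht ↦ (hc t ht).continuousAt.continuousWithinAt)
      (fun t ht ↦ (hc t (Ico_subset_Icc_self ht)).hasDerivWithinAt) le_rfl
      (fun t ht ↦ by
        calc ‖F (c t)‖ = ‖(F (c t) - J (c t)) + J (c t)‖ := by simp
          _ ≤ ε * ‖c t‖ + ‖J‖ * ‖c t‖ := (norm_add_le _ _).trans
            (add_le_add (hF _ (hcr t (Ico_subset_Icc_self ht))) (J.le_opNorm _))
          _ ≤ (‖J‖ + 1) * ‖c t‖ + 0 := by nlinarith [norm_nonneg (c t)]) s hs
    rw [gronwallBound_ε0] at this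
    exact this.trans (mul_le_mul_of_nonneg_left (hexp s hs) (norm_nonneg _))
  refine ⟨h1 t ht, ?_⟩
  have hd : ∀ s ∈ Icc (0 : ℝ) T, HasDerivAt (fun s ↦ c s - NormedSpace.exp (s • J) (c 0))
      (F (c s) - J (NormedSpace.exp (s • J) (c 0))) s := fun s hs ↦ by
    have := (hasDerivAt_exp_smul_const' J s).clm_apply (hasDerivAt_const s (c 0))
    exact (hc s hs).sub (by simpa using this)
  have := norm_le_gronwallBound_of_norm_deriv_right_le
    (δ := 0) (K := ‖J‖ + 1) (ε := ε * (‖c 0‖ * Real.exp (‖J‖ + 1)))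
    (fun t ht ↦ (hd t ht).continuousAt.continuousWithinAt)
    (fun t ht ↦ (hd t (Ico_subset_Icc_self ht)).hasDerivWithinAt) (by simp)
    (fun s hs ↦ by
      have hs' := Ico_subset_Icc_self hs
      calc ‖F (c s) - J (NormedSpace.exp (s • J) (c 0))‖
          = ‖J (c s - NormedSpace.exp (s • J) (c 0)) + (F (c s) - J (c s))‖ := by simp
        _ ≤ ‖J‖ * ‖c s - NormedSpace.exp (s • J) (c 0)‖ + ε * ‖c s‖ := (norm_add_le _ _).trans
            (add_le_add (J.le_opNorm _) (hF _ (hcr s hs')))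
        _ ≤ (‖J‖ + 1) * ‖c s - NormedSpace.exp (s • J) (c 0)‖ +
            ε * (‖c 0‖ * Real.exp (‖J‖ + 1)) := by
          gcongr
          · linarith
          · exact h1 s hs') t ht
  refine this.trans ?_
  simp only [gronwallBound_of_K_ne_0 hK.ne', zero_mul, zero_add]
  have h2 : ε * (‖c 0‖ * Real.exp (‖J‖ + 1)) / (‖J‖ + 1) ≤ ε * (‖c 0‖ * Real.exp (‖J‖ + 1)) :=
    div_le_self (by positivity) (by linarith [norm_nonneg J])
  have h3 : 0 ≤ Real.exp ((‖J‖ + 1) * (t - 0)) - 1 := by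
    have := Real.one_le_exp (x := (‖J‖ + 1) * (t - 0)) (by have := ht.1; simp; positivity)
    linarith
  calc _ ≤ ε * (‖c 0‖ * Real.exp (‖J‖ + 1)) * Real.exp (‖J‖ + 1) := by
        refine mul_le_mul h2 ?_ h3 (by positivity)
        linarith [hexp t ht]
    _ = _ := by ring

variable {p q : ℕ} {M : Type*} [TopologicalSpace M] [ChartedSpace (Vec p q) M]

/-- The components of a vector field in the chart `φ`. -/
def localField (φ : OpenPartialHomeomorph M (Vec p q))
    (ξ : ∀ x : M, TangentSpace 𝓘(ℝ, Vec p q) x) (y : Vec p q) : Vec p q :=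
  coords φ (φ.symm y) (ξ (φ.symm y))

variable {φ : OpenPartialHomeomorph M (Vec p q)} {ξ : ∀ x : M, TangentSpace 𝓘(ℝ, Vec p q) x}

theorem mdifferentiable_of_mem_maximalAtlas
    (hφ : φ ∈ IsManifold.maximalAtlas 𝓘(ℝ, Vec p q) ∞ M) :
    φ.MDifferentiable 𝓘(ℝ, Vec p q) 𝓘(ℝ, Vec p q) :=
  ⟨(contMDiffOn_of_mem_maximalAtlas hφ).mdifferentiableOn (by simp),
    (contMDiffOn_symm_of_mem_maximalAtlas hφ).mdifferentiableOn (by simp)⟩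

theorem hasDerivAt_integralCurve (hφ : φ.MDifferentiable 𝓘(ℝ, Vec p q) 𝓘(ℝ, Vec p q))
    {γ : ℝ → M} (hγ : IsMIntegralCurve (I := 𝓘(ℝ, Vec p q)) γ ξ) {t : ℝ} (ht : γ t ∈ φ.source) :
    HasDerivAt (fun t ↦ φ (γ t)) (localField φ ξ (φ (γ t))) t := by
  let L : ℝ →L[ℝ] Vec p q := (mfderiv 𝓘(ℝ, Vec p q) 𝓘(ℝ, Vec p q) φ (γ t)).comp
    (ContinuousLinearMap.smulRight (1 : ℝ →L[ℝ] ℝ) (ξ (γ t)))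
  have h1 : HasFDerivAt (fun t ↦ φ (γ t)) L t :=
    ((hφ.mdifferentiableAt ht).hasMFDerivAt.comp t (hγ t)).hasFDerivAt
  have h2 : localField φ ξ (φ (γ t)) = coords φ (γ t) (ξ (γ t)) := by
    unfold localField
    rw [φ.left_inv ht]
  rw [h2]
  have h3 : L 1 = coords φ (γ t) (ξ (γ t)) := by
    change mfderiv 𝓘(ℝ, Vec p q) 𝓘(ℝ, Vec p q) φ (γ t) ((1 : ℝ) • ξ (γ t)) = _
    rw [one_smul]
    rfl
  rw [← h3]
  exact h1.hasDerivAt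

theorem contDiffOn_localField [IsManifold 𝓘(ℝ, Vec p q) ∞ M]
    (hφ : φ ∈ IsManifold.maximalAtlas 𝓘(ℝ, Vec p q) ∞ M)
    (hξ : ContMDiff 𝓘(ℝ, Vec p q) 𝓘(ℝ, Vec p q).tangent ∞
      (fun x ↦ (⟨x, ξ x⟩ : TangentBundle 𝓘(ℝ, Vec p q) M))) :
    ContDiffOn ℝ ∞ (localField φ ξ) φ.target := by
  have h1 := (contMDiffOn_of_mem_maximalAtlas hφ).contMDiffOn_tangentMapWithin (m := ∞) (by simp)
    φ.open_source.uniqueMDiffOn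
  have h2 := h1.comp hξ.contMDiffOn (s := φ.source) (fun x hx ↦ hx)
  have h3 := h2.comp (contMDiffOn_symm_of_mem_maximalAtlas hφ) (fun y hy ↦ φ.map_target hy)
  have h4 := (contMDiff_snd_tangentBundle_modelSpace (n := ∞) (Vec p q)
    𝓘(ℝ, Vec p q)).comp_contMDiffOn h3
  refine (contMDiffOn_iff_contDiffOn.1 h4).congr fun y hy ↦ ?_
  have := mfderivWithin_of_isOpen (I := 𝓘(ℝ, Vec p q)) (I' := 𝓘(ℝ, Vec p q)) (f := φ)
    φ.open_source (φ.map_target hy)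
  exact congrArg (fun L ↦ L (ξ (φ.symm y))) this.symm

/-- Integral curves that start near a zero of `ξ` stay near it up to time `1`, and are to first
order given by the exponential of the linearization of `ξ`. -/
theorem exists_integralCurve_estimate [T2Space M]
    (hφ : φ.MDifferentiable 𝓘(ℝ, Vec p q) 𝓘(ℝ, Vec p q)) (h0 : (0 : Vec p q) ∈ φ.target)
    {J : Vec p q →L[ℝ] Vec p q} (hF : HasFDerivAt (localField φ ξ) J 0)
    (hF0 : localField φ ξ 0 = 0) {ε : ℝ} (hε : 0 < ε) :
    ∃ δ > 0, ∀ γ : ℝ → M, IsMIntegralCurve (I := 𝓘(ℝ, Vec p q)) γ ξ → γ 0 ∈ φ.source →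
      ‖φ (γ 0)‖ < δ → ∀ t ∈ Icc (0 : ℝ) 1,
        ‖φ (γ t) - NormedSpace.exp (t • J) (φ (γ 0))‖ ≤ ε * ‖φ (γ 0)‖ := by
  set K := Real.exp (‖J‖ + 1) with hK
  have hK1 : 1 ≤ K := Real.one_le_exp (by positivity)
  set η := min 1 (ε / (K * K)) with hη
  have hη0 : 0 < η := by positivity
  have hloc := (hasFDerivAt_iff_isLittleO_nhds_zero.1 hF).def hη0
  obtain ⟨r, hr, hball⟩ := (Metric.nhds_basis_closedBall (x := (0 : Vec p q))).eventually_iff.1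
    (hloc.and (φ.open_target.mem_nhds h0))
  have hFr : ∀ y : Vec p q, ‖y‖ ≤ r → ‖localField φ ξ y - J y‖ ≤ η * ‖y‖ := fun y hy ↦ by
    simpa [hF0] using (hball (mem_closedBall_zero_iff.2 hy)).1
  have hsub : Metric.closedBall (0 : Vec p q) r ⊆ φ.target := fun y hy ↦ (hball hy).2
  have hKr : 0 < r / K := by positivity
  refine ⟨r / K, by positivity, fun γ hγ hγ0 hγδ ↦ ?_⟩
  have hγc : Continuous γ := continuous_iff_continuousAt.2 fun t ↦ (hγ t).continuousAt
  let C : Set M := φ.symm '' Metric.closedBall 0 r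
  have hCcl : IsClosed C :=
    ((isCompact_closedBall 0 r).image_of_continuousOn (φ.symm.continuousOn.mono hsub)).isClosed
  have hCs : ∀ x ∈ C, x ∈ φ.source ∧ ‖φ x‖ ≤ r := by
    rintro _ ⟨y, hy, rfl⟩
    exact ⟨φ.map_target (hsub hy), by simpa [φ.right_inv (hsub hy)] using hy⟩
  let V : Set M := φ.source ∩ φ ⁻¹' Metric.ball 0 r
  have hVo : IsOpen V := φ.isOpen_inter_preimage Metric.isOpen_ball
  have hVC : V ⊆ C := fun x hx ↦
    ⟨φ x, Metric.ball_subset_closedBall hx.2, φ.left_inv hx.1⟩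
  have hest : ∀ T ≤ (1 : ℝ), (∀ t ∈ Icc (0 : ℝ) T, γ t ∈ C) → ∀ t ∈ Icc (0 : ℝ) T,
      ‖φ (γ t)‖ ≤ ‖φ (γ 0)‖ * K ∧ ‖φ (γ t) - NormedSpace.exp (t • J) (φ (γ 0))‖ ≤
        η * (K * K) * ‖φ (γ 0)‖ := fun T hT hTC t ht ↦
    norm_sub_exp_le (c := fun t ↦ φ (γ t)) (min_le_left _ _) hη0.le hFr hT
      (fun t ht ↦ hasDerivAt_integralCurve hφ hγ (hCs _ (hTC t ht)).1)
      (fun t ht ↦ (hCs _ (hTC t ht)).2) ht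
  -- at the first time at which the curve leaves `V`, it still lies in `C`, and the estimate on the
  -- interval up to that time puts it into `V`
  have hstay : ∀ t ∈ Icc (0 : ℝ) 1, γ t ∈ V := by
    by_contra! hcon
    have hB : IsCompact (Icc (0 : ℝ) 1 ∩ γ ⁻¹' Vᶜ) :=
      isCompact_Icc.inter_right (hVo.isClosed_compl.preimage hγc)
    obtain ⟨T, hTB, hTmin⟩ := hB.exists_isLeast hcon
    have h0V : γ 0 ∈ V := ⟨hγ0, by
      simpa using hγδ.trans_le (div_le_self hr.le hK1)⟩
    have hT0 : 0 < T := hTB.1.1.lt_of_ne fun h ↦ hTB.2 (h ▸ h0V)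
    have hTC : ∀ t ∈ Icc (0 : ℝ) T, γ t ∈ C := by
      have h1 : Ico 0 T ⊆ γ ⁻¹' C := fun t ht ↦ hVC <| by
        by_contra h
        exact absurd (hTmin ⟨⟨ht.1, ht.2.le.trans hTB.1.2⟩, h⟩) (not_le.2 ht.2)
      have h2 := closure_minimal h1 (hCcl.preimage hγc)
      rw [closure_Ico hT0.ne] at h2
      exact h2
    have hTT : T ∈ Icc 0 T := ⟨hT0.le, le_rfl⟩
    refine hTB.2 ⟨(hCs _ (hTC T hTT)).1, ?_⟩
    have := (hest T hTB.1.2 hTC T hTT).1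
    simpa using this.trans_lt ((lt_div_iff₀ (by positivity)).1 hγδ)
  intro t ht
  refine (hest 1 le_rfl (fun t ht ↦ hVC (hstay t ht)) t ht).2.trans ?_
  gcongr
  calc η * (K * K) ≤ ε / (K * K) * (K * K) := by gcongr; exact min_le_right _ _
    _ = ε := by field_simp

theorem hasFDerivAt_flow [T2Space M]
    (hφ : φ.MDifferentiable 𝓘(ℝ, Vec p q) 𝓘(ℝ, Vec p q)) (h0 : (0 : Vec p q) ∈ φ.target)
    {J : Vec p q →L[ℝ] Vec p q} (hF : HasFDerivAt (localField φ ξ) J 0)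
    (hF0 : localField φ ξ 0 = 0) {Fl : ℝ → M → M} (hFl0 : ∀ x, Fl 0 x = x)
    (hFl : ∀ x, IsMIntegralCurve (I := 𝓘(ℝ, Vec p q)) (fun t ↦ Fl t x) ξ) {t : ℝ}
    (ht : t ∈ Icc (0 : ℝ) 1) (hfix : Fl t (φ.symm 0) = φ.symm 0) :
    HasFDerivAt (φ ∘ Fl t ∘ φ.symm) (NormedSpace.exp (t • J)) 0 := by
  refine hasFDerivAt_iff_isLittleO_nhds_zero.2 (Asymptotics.isLittleO_iff.2 fun ε hε ↦ ?_)
  obtain ⟨δ, hδ, h⟩ := exists_integralCurve_estimate hφ h0 hF hF0 hε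
  filter_upwards [Metric.ball_mem_nhds (0 : Vec p q) hδ, φ.open_target.mem_nhds h0] with y hy hyt
  have h1 := h _ (hFl (φ.symm y)) (by rw [hFl0]; exact φ.map_target hyt)
    (by rw [hFl0, φ.right_inv hyt]; simpa using hy) t ht
  simp only [hFl0, φ.right_inv hyt] at h1
  simpa [hfix, φ.right_inv h0] using h1

theorem toMatrix'_exp {n : Type*} [Fintype n] [DecidableEq n] (J : (n → ℝ) →L[ℝ] (n → ℝ)) :
    LinearMap.toMatrix' (NormedSpace.exp J : (n → ℝ) →L[ℝ] (n → ℝ)).toLinearMap =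
      NormedSpace.exp (LinearMap.toMatrix' J.toLinearMap) := by
  open scoped Matrix.Norms.Operator in
  let Φ : ((n → ℝ) →L[ℝ] (n → ℝ)) →+* Matrix n n ℝ :=
    (LinearMap.toMatrixAlgEquiv' :
      ((n → ℝ) →ₗ[ℝ] n → ℝ) ≃ₐ[ℝ] Matrix n n ℝ).toRingEquiv.toRingHom.comp
      ContinuousLinearMap.toLinearMapRingHom
  have hΦ : Continuous Φ := by
    let Φ' : ((n → ℝ) →L[ℝ] (n → ℝ)) →ₗ[ℝ] Matrix n n ℝ :=
      (LinearMap.toMatrix' : ((n → ℝ) →ₗ[ℝ] n → ℝ) ≃ₗ[ℝ] Matrix n n ℝ).toLinearMap ∘ₗ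
        ContinuousLinearMap.coeLM ℝ
    exact Φ'.continuous_of_finiteDimensional
  let _ : NormedAlgebra ℚ ((n → ℝ) →L[ℝ] (n → ℝ)) := NormedAlgebra.restrictScalars ℚ ℝ _
  exact NormedSpace.map_exp Φ hΦ J

end Flow

/-! ### Differentials of maps and Jacobians in a chart -/

section Charts

set_option maxSynthPendingDepth 3

theorem jacobian_id {p q : ℕ} {M : Type*} [TopologicalSpace M]
    {φ : OpenPartialHomeomorph M (Vec p q)} {x : M} (hx : x ∈ φ.source) : jacobian φ id x = 1 := by
  have h : (φ ∘ id ∘ φ.symm : Vec p q → Vec p q) =ᶠ[𝓝 (φ x)] id := by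
    filter_upwards [φ.open_target.mem_nhds (φ.map_source hx)] with y hy
    exact φ.right_inv hy
  rw [jacobian, h.fderiv_eq, fderiv_id]
  exact LinearMap.toMatrix'_id

variable {p q : ℕ} {M : Type*} [TopologicalSpace M] [ChartedSpace (Vec p q) M]
  {φ : OpenPartialHomeomorph M (Vec p q)}

theorem mfderiv_symm_coords (hφ : φ.MDifferentiable 𝓘(ℝ, Vec p q) 𝓘(ℝ, Vec p q)) {x : M}
    (hx : x ∈ φ.source) (v : TangentSpace 𝓘(ℝ, Vec p q) x) :
    mfderiv 𝓘(ℝ, Vec p q) 𝓘(ℝ, Vec p q) φ.symm (φ x) (coords φ x v) = v :=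
  congrArg (fun L : TangentSpace 𝓘(ℝ, Vec p q) x →L[ℝ] TangentSpace 𝓘(ℝ, Vec p q) x ↦ L v)
    (hφ.symm_comp_deriv hx)

theorem coords_coordVector (hφ : φ.MDifferentiable 𝓘(ℝ, Vec p q) 𝓘(ℝ, Vec p q)) {x : M}
    (hx : x ∈ φ.source) (μ : Fin p ⊕ Fin q) :
    coords φ x (coordVector φ x μ) = Pi.single μ 1 := by
  have h : (mfderiv 𝓘(ℝ, Vec p q) 𝓘(ℝ, Vec p q) φ x).IsInvertible := ⟨hφ.mfderiv hx, rfl⟩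
  exact h.self_apply_inverse _

theorem coords_injective (hφ : φ.MDifferentiable 𝓘(ℝ, Vec p q) 𝓘(ℝ, Vec p q)) {x : M}
    (hx : x ∈ φ.source) : Function.Injective (coords φ x) :=
  hφ.mfderiv_injective hx

theorem coords_surjective (hφ : φ.MDifferentiable 𝓘(ℝ, Vec p q) 𝓘(ℝ, Vec p q)) {x : M}
    (hx : x ∈ φ.source) : Function.Surjective (coords φ x) :=
  hφ.mfderiv_surjective hx

theorem sum_smul_coordVector (hφ : φ.MDifferentiable 𝓘(ℝ, Vec p q) 𝓘(ℝ, Vec p q)) {x : M}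
    (hx : x ∈ φ.source) (v : TangentSpace 𝓘(ℝ, Vec p q) x) :
    ∑ κ, coords φ x v κ • coordVector φ x κ = v := by
  refine coords_injective hφ hx ?_
  have h : coords φ x (∑ κ, coords φ x v κ • coordVector φ x κ) =
      ∑ κ, coords φ x v κ • coords φ x (coordVector φ x κ) :=
    (map_sum (mfderiv 𝓘(ℝ, Vec p q) 𝓘(ℝ, Vec p q) φ x) _ _).trans
      (Finset.sum_congr rfl fun κ _ ↦ map_smul _ _ _)
  rw [h]
  simp only [coords_coordVector hφ hx]
  ext μ
  simp [Finset.sum_apply, Pi.single_apply]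

theorem hasFDerivAt_chart_conj (hφ : φ.MDifferentiable 𝓘(ℝ, Vec p q) 𝓘(ℝ, Vec p q)) {f : M → M}
    {x : M} (hx : x ∈ φ.source) (hfx : f x ∈ φ.source)
    (hf : MDifferentiableAt 𝓘(ℝ, Vec p q) 𝓘(ℝ, Vec p q) f x) :
    HasFDerivAt (φ ∘ f ∘ φ.symm) ((mfderiv 𝓘(ℝ, Vec p q) 𝓘(ℝ, Vec p q) φ (f x)).comp
      ((mfderiv 𝓘(ℝ, Vec p q) 𝓘(ℝ, Vec p q) f x).comp
        (mfderiv 𝓘(ℝ, Vec p q) 𝓘(ℝ, Vec p q) φ.symm (φ x)))) (φ x) := by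
  have h1 := (hφ.mdifferentiableAt_symm (φ.map_source hx)).hasMFDerivAt
  have h2 : HasMFDerivAt 𝓘(ℝ, Vec p q) 𝓘(ℝ, Vec p q) f (φ.symm (φ x))
      (mfderiv 𝓘(ℝ, Vec p q) 𝓘(ℝ, Vec p q) f x) := by
    rw [φ.left_inv hx]
    exact hf.hasMFDerivAt
  have h3 : HasMFDerivAt 𝓘(ℝ, Vec p q) 𝓘(ℝ, Vec p q) φ ((f ∘ φ.symm) (φ x))
      (mfderiv 𝓘(ℝ, Vec p q) 𝓘(ℝ, Vec p q) φ (f x)) := by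
    rw [Function.comp_apply, φ.left_inv hx]
    exact (hφ.mdifferentiableAt hfx).hasMFDerivAt
  exact (h3.comp (φ x) (h2.comp (φ x) h1)).hasFDerivAt

theorem fderiv_chart_conj_apply (hφ : φ.MDifferentiable 𝓘(ℝ, Vec p q) 𝓘(ℝ, Vec p q)) {f : M → M}
    {x : M} (hx : x ∈ φ.source) (hfx : f x ∈ φ.source)
    (hf : MDifferentiableAt 𝓘(ℝ, Vec p q) 𝓘(ℝ, Vec p q) f x) (a : Vec p q) :
    fderiv ℝ (φ ∘ f ∘ φ.symm) (φ x) a = coords φ (f x) (mfderiv 𝓘(ℝ, Vec p q) 𝓘(ℝ, Vec p q) f x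
      (mfderiv 𝓘(ℝ, Vec p q) 𝓘(ℝ, Vec p q) φ.symm (φ x) a)) := by
  let L : Vec p q →L[ℝ] Vec p q := (mfderiv 𝓘(ℝ, Vec p q) 𝓘(ℝ, Vec p q) φ (f x)).comp
      ((mfderiv 𝓘(ℝ, Vec p q) 𝓘(ℝ, Vec p q) f x).comp
        (mfderiv 𝓘(ℝ, Vec p q) 𝓘(ℝ, Vec p q) φ.symm (φ x)))
  have h : HasFDerivAt (φ ∘ f ∘ φ.symm) L (φ x) := hasFDerivAt_chart_conj hφ hx hfx hf
  rw [h.fderiv]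
  rfl

theorem coords_mfderiv (hφ : φ.MDifferentiable 𝓘(ℝ, Vec p q) 𝓘(ℝ, Vec p q)) {f : M → M}
    {x : M} (hx : x ∈ φ.source) (hfx : f x ∈ φ.source)
    (hf : MDifferentiableAt 𝓘(ℝ, Vec p q) 𝓘(ℝ, Vec p q) f x)
    (v : TangentSpace 𝓘(ℝ, Vec p q) x) :
    coords φ (f x) (mfderiv 𝓘(ℝ, Vec p q) 𝓘(ℝ, Vec p q) f x v) =
      jacobian φ f x *ᵥ coords φ x v := by
  rw [jacobian, LinearMap.toMatrix'_mulVec, ContinuousLinearMap.coe_coe,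
    fderiv_chart_conj_apply hφ hx hfx hf, mfderiv_symm_coords hφ hx]

theorem jacobian_comp (hφ : φ.MDifferentiable 𝓘(ℝ, Vec p q) 𝓘(ℝ, Vec p q)) {f h : M → M}
    {x : M} (hx : x ∈ φ.source) (hhx : h x ∈ φ.source) (hfhx : f (h x) ∈ φ.source)
    (hf : MDifferentiableAt 𝓘(ℝ, Vec p q) 𝓘(ℝ, Vec p q) f (h x))
    (hh : MDifferentiableAt 𝓘(ℝ, Vec p q) 𝓘(ℝ, Vec p q) h x) :
    jacobian φ (f ∘ h) x = jacobian φ f (h x) * jacobian φ h x := by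
  have hmv : ∀ a : Vec p q,
      jacobian φ (f ∘ h) x *ᵥ a = (jacobian φ f (h x) * jacobian φ h x) *ᵥ a := by
    intro a
    obtain ⟨v, rfl⟩ := coords_surjective hφ hx a
    rw [← coords_mfderiv hφ hx hfhx (hf.comp x hh),
      mfderiv_comp x hf hh, ← Matrix.mulVec_mulVec, ← coords_mfderiv hφ hx hhx hh,
      ← coords_mfderiv hφ hhx hfhx hf]
    rfl
  exact Matrix.mulVec_injective (funext hmv)

theorem contDiffAt_chart_conj (hφ : φ ∈ IsManifold.maximalAtlas 𝓘(ℝ, Vec p q) ∞ M)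
    [IsManifold 𝓘(ℝ, Vec p q) ∞ M] {f : M → M}
    (hf : ContMDiff 𝓘(ℝ, Vec p q) 𝓘(ℝ, Vec p q) ∞ f) {x : M} (hx : x ∈ φ.source)
    (hfx : f x ∈ φ.source) : ContDiffAt ℝ ∞ (φ ∘ f ∘ φ.symm) (φ x) := by
  have h1 : ContMDiffAt 𝓘(ℝ, Vec p q) 𝓘(ℝ, Vec p q) ∞ φ.symm (φ x) :=
    (contMDiffOn_symm_of_mem_maximalAtlas hφ).contMDiffAt
      (φ.open_target.mem_nhds (φ.map_source hx))
  have h2 : ContMDiffAt 𝓘(ℝ, Vec p q) 𝓘(ℝ, Vec p q) ∞ φ ((f ∘ φ.symm) (φ x)) := by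
    rw [Function.comp_apply, φ.left_inv hx]
    exact (contMDiffOn_of_mem_maximalAtlas hφ).contMDiffAt (φ.open_source.mem_nhds hfx)
  exact (h2.comp (φ x) (hf.contMDiffAt.comp (φ x) h1)).contDiffAt

end Charts

/-! ### Isometries fixing a point are determined by their differential there -/

section Isometries

set_option maxSynthPendingDepth 3

variable {p q : ℕ} {M : Type*} [TopologicalSpace M] [ChartedSpace (Vec p q) M]
  [IsManifold 𝓘(ℝ, Vec p q) ∞ M] {g : SemiRiemannianMetric p q M} {O : M}
  {φ : OpenPartialHomeomorph M (Vec p q)}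

theorem IsIsometryFixing.one : IsIsometryFixing g O 1 :=
  ⟨contMDiff_id, contMDiff_id, rfl, fun x v w ↦ by
    rw [show ((1 : Equiv.Perm M) : M → M) = id from rfl, mfderiv_id]
    rfl⟩

theorem IsIsometryFixing.mul {f h : Equiv.Perm M} (hf : IsIsometryFixing g O f)
    (hh : IsIsometryFixing g O h) : IsIsometryFixing g O (f * h) := by
  refine ⟨hf.smooth.comp hh.smooth, hh.smooth_symm.comp hf.smooth_symm, ?_, fun x v w ↦ ?_⟩
  · rw [Equiv.Perm.mul_apply, hh.fixes, hf.fixes]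
  · rw [← hh.isometry x, ← hf.isometry (h x), Equiv.Perm.coe_mul, mfderiv_comp x
      (hf.smooth.mdifferentiable (by simp) _) (hh.smooth.mdifferentiable (by simp) _)]
    rfl

theorem IsIsometryFixing.mfderiv_comp_symm {f : Equiv.Perm M} (hf : IsIsometryFixing g O f) (x : M)
    (v : TangentSpace 𝓘(ℝ, Vec p q) (f x)) :
    mfderiv 𝓘(ℝ, Vec p q) 𝓘(ℝ, Vec p q) f x
      (mfderiv 𝓘(ℝ, Vec p q) 𝓘(ℝ, Vec p q) f.symm (f x) v) = v := by
  have h := mfderiv_comp (f x) (g := f) (f := f.symm) (hf.smooth.mdifferentiable (by simp) _)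
    (hf.smooth_symm.mdifferentiable (by simp) _)
  rw [show (f ∘ f.symm : M → M) = id from funext f.apply_symm_apply, mfderiv_id,
    f.symm_apply_apply] at h
  exact (congrArg (fun L : TangentSpace 𝓘(ℝ, Vec p q) (f x) →L[ℝ]
    TangentSpace 𝓘(ℝ, Vec p q) (f x) ↦ L v) h).symm

theorem IsIsometryFixing.inv {f : Equiv.Perm M} (hf : IsIsometryFixing g O f) :
    IsIsometryFixing g O f⁻¹ := by
  refine ⟨hf.smooth_symm, hf.smooth, ?_, fun x v w ↦ ?_⟩
  · rw [Equiv.Perm.inv_eq_iff_eq, hf.fixes]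
  · obtain ⟨x, rfl⟩ := f.surjective x
    have h := hf.isometry x (mfderiv 𝓘(ℝ, Vec p q) 𝓘(ℝ, Vec p q) f.symm (f x) v)
      (mfderiv 𝓘(ℝ, Vec p q) 𝓘(ℝ, Vec p q) f.symm (f x) w)
    rw [hf.mfderiv_comp_symm, hf.mfderiv_comp_symm] at h
    rw [h, Equiv.Perm.inv_def, f.symm_apply_apply]

theorem IsIsometryFixing.mfderiv_isInvertible {f : Equiv.Perm M} (hf : IsIsometryFixing g O f)
    (x : M) : (mfderiv 𝓘(ℝ, Vec p q) 𝓘(ℝ, Vec p q) f x).IsInvertible := by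
  refine ContinuousLinearMap.IsInvertible.of_inverse
    (g := mfderiv 𝓘(ℝ, Vec p q) 𝓘(ℝ, Vec p q) f.symm (f x)) ?_ ?_
  · ext1 v
    exact hf.mfderiv_comp_symm x v
  · have h := mfderiv_comp x (g := f.symm) (f := f) (hf.smooth_symm.mdifferentiable (by simp) _)
      (hf.smooth.mdifferentiable (by simp) _)
    rw [show (f.symm ∘ f : M → M) = id from funext f.symm_apply_apply, mfderiv_id] at h
    exact h.symm

/-- The metric as a function of the coordinates with values in the bilinear forms: the pull-back of
`g` by the inverse of the chart. -/
def metricInChart (g : SemiRiemannianMetric p q M) (φ : OpenPartialHomeomorph M (Vec p q))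
    (y : Vec p q) : Vec p q →L[ℝ] Vec p q →L[ℝ] ℝ :=
  ((ContinuousLinearMap.compL ℝ (Vec p q) (Vec p q) ℝ).flip
      (mfderiv 𝓘(ℝ, Vec p q) 𝓘(ℝ, Vec p q) φ.symm y)).comp
    ((g.inner (φ.symm y)).comp (mfderiv 𝓘(ℝ, Vec p q) 𝓘(ℝ, Vec p q) φ.symm y))

theorem metricInChart_apply (y a b : Vec p q) : metricInChart g φ y a b =
    g.inner (φ.symm y) (mfderiv 𝓘(ℝ, Vec p q) 𝓘(ℝ, Vec p q) φ.symm y a)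
      (mfderiv 𝓘(ℝ, Vec p q) 𝓘(ℝ, Vec p q) φ.symm y b) := rfl

theorem contDiffOn_metricInChart (hφ : φ ∈ IsManifold.maximalAtlas 𝓘(ℝ, Vec p q) ∞ M) :
    ContDiffOn ℝ ∞ (metricInChart g φ) φ.target := by
  refine contDiffOn_clm_apply.2 fun a ↦ contDiffOn_clm_apply.2 fun b ↦ ?_
  have hV : ∀ a : Vec p q, ContMDiffOn 𝓘(ℝ, Vec p q) 𝓘(ℝ, Vec p q).tangent ∞
      (fun y ↦ (⟨φ.symm y, mfderiv 𝓘(ℝ, Vec p q) 𝓘(ℝ, Vec p q) φ.symm y a⟩ :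
        TangentBundle 𝓘(ℝ, Vec p q) M)) φ.target := fun a ↦ by
    have h1 := (contMDiffOn_symm_of_mem_maximalAtlas hφ).contMDiffOn_tangentMapWithin (m := ∞)
      (by simp) φ.open_target.uniqueMDiffOn
    have h2 : ContMDiff 𝓘(ℝ, Vec p q) 𝓘(ℝ, Vec p q).tangent ∞
        (fun y ↦ (⟨y, a⟩ : TangentBundle 𝓘(ℝ, Vec p q) (Vec p q))) :=
      contMDiff_vectorSpace_iff_contDiff.2 contDiff_const
    refine (h1.comp h2.contMDiffOn (s := φ.target) (fun y hy ↦ hy)).congr fun y hy ↦ ?_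
    have := mfderivWithin_of_isOpen (I := 𝓘(ℝ, Vec p q)) (I' := 𝓘(ℝ, Vec p q)) (f := φ.symm)
      φ.open_target hy
    exact congrArg (fun L : Vec p q →L[ℝ] Vec p q ↦
      (⟨φ.symm y, L a⟩ : TangentBundle 𝓘(ℝ, Vec p q) M)) this.symm
  have hg := g.contMDiff.comp_contMDiffOn (contMDiffOn_symm_of_mem_maximalAtlas hφ)
  rw [← contMDiffOn_iff_contDiffOn]
  intro y hy
  have h3 : ContMDiffWithinAt 𝓘(ℝ, Vec p q) (𝓘(ℝ, Vec p q).prod 𝓘(ℝ, ℝ)) ∞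
    (fun y ↦ Bundle.TotalSpace.mk' ℝ (E := Bundle.Trivial M ℝ) (φ.symm y)
      (g.inner (φ.symm y) (mfderiv 𝓘(ℝ, Vec p q) 𝓘(ℝ, Vec p q) φ.symm y a)
        (mfderiv 𝓘(ℝ, Vec p q) 𝓘(ℝ, Vec p q) φ.symm y b))) φ.target y :=
    ContMDiffWithinAt.clm_bundle_apply₂ (F₁ := Vec p q) (F₂ := Vec p q) (hg y hy) (hV a y hy)
      (hV b y hy)
  exact (Bundle.contMDiffWithinAt_totalSpace.1 h3).2

theorem SemiRiemannianMetric.eq_zero_of_forall_inner_eq_zero {x : M}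
    {v : TangentSpace 𝓘(ℝ, Vec p q) x} (h : ∀ w, g.inner x v w = 0) : v = 0 := by
  obtain ⟨b, hb⟩ := g.signature x
  refine b.ext_elem fun j ↦ ?_
  have h1 := h (b j)
  rw [← b.sum_repr v] at h1
  simp only [map_sum, map_smul, sum_apply, smul_apply, hb,
    smul_eq_mul] at h1
  have h2 : ∀ i, b.repr v i * Ipq p q i j = if i = j then b.repr v j * Ipq p q j j else 0 := by
    intro i
    split_ifs with hij
    · rw [hij]
    · rw [Ipq, LieAlgebra.Orthogonal.indefiniteDiagonal, Matrix.diagonal_apply_ne _ hij, mul_zero]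
  rw [Finset.sum_congr rfl fun i _ ↦ h2 i, Finset.sum_ite_eq', if_pos (Finset.mem_univ j)] at h1
  rcases mul_eq_zero.1 h1 with h3 | h3
  · simpa using h3
  · exact absurd h3 (Ipq_apply_self_ne_zero j)

theorem IsIsometryFixing.eventually_eq_self {f : Equiv.Perm M} (hf : IsIsometryFixing g O f)
    (hφ : φ ∈ IsManifold.maximalAtlas 𝓘(ℝ, Vec p q) ∞ M) {x₀ : M} (hx₀ : x₀ ∈ φ.source)
    (hfx : f x₀ = x₀) (hf' : fderiv ℝ (φ ∘ f ∘ φ.symm) (φ x₀) = 1) : ∀ᶠ x in 𝓝 x₀, f x = x := by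
  have hφd := mdifferentiable_of_mem_maximalAtlas hφ
  have ht : φ.target ∈ 𝓝 (φ x₀) := φ.open_target.mem_nhds (φ.map_source hx₀)
  have hfφ : Continuous f := hf.smooth.continuous
  have hmem : ∀ᶠ y in 𝓝 (φ x₀), f (φ.symm y) ∈ φ.source := by
    have hc : ContinuousAt (f ∘ φ.symm) (φ x₀) :=
      hfφ.continuousAt.comp (φ.continuousAt_symm (φ.map_source hx₀))
    refine hc.eventually_mem (φ.open_source.mem_nhds ?_)
    rwa [Function.comp_apply, φ.left_inv hx₀, hfx]
  have hev : ∀ᶠ y in 𝓝 (φ x₀), (φ ∘ f ∘ φ.symm) y = y := by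
    refine eventually_eq_self_of_isometry (G := metricInChart g φ) ?_ ?_ ?_ ?_ ?_ hf' ?_
    · exact ((contDiffOn_metricInChart hφ).contDiffAt ht).of_le (by norm_cast)
    · exact Eventually.of_forall fun y v w ↦ g.symm _ _ _
    · refine (injective_iff_map_eq_zero _).2 fun a ha ↦ ?_
      have h0 : mfderiv 𝓘(ℝ, Vec p q) 𝓘(ℝ, Vec p q) φ.symm (φ x₀) a = 0 := by
        refine SemiRiemannianMetric.eq_zero_of_forall_inner_eq_zero (g := g) fun w ↦ ?_
        obtain ⟨b, rfl⟩ := hφd.symm.mfderiv_surjective (φ.map_source hx₀) w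
        exact congrArg (fun L : Vec p q →L[ℝ] ℝ ↦ L b) ha
      exact hφd.symm.mfderiv_injective (φ.map_source hx₀) (h0.trans (map_zero _).symm)
    · exact (contDiffAt_chart_conj hφ hf.smooth hx₀ (by rwa [hfx])).of_le (by norm_cast)
    · simp [φ.left_inv hx₀, hfx]
    · filter_upwards [ht, hmem] with y hy hfy w u
      have hD : ∀ w, mfderiv 𝓘(ℝ, Vec p q) 𝓘(ℝ, Vec p q) φ.symm (φ (f (φ.symm y)))
          (fderiv ℝ (φ ∘ f ∘ φ.symm) y w) = mfderiv 𝓘(ℝ, Vec p q) 𝓘(ℝ, Vec p q) f (φ.symm y)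
            (mfderiv 𝓘(ℝ, Vec p q) 𝓘(ℝ, Vec p q) φ.symm y w) := fun w ↦ by
        have h1 := fderiv_chart_conj_apply hφd (φ.map_target hy) hfy
          (hf.smooth.mdifferentiable (by simp) _) w
        rw [φ.right_inv hy] at h1
        rw [h1]
        exact mfderiv_symm_coords hφd hfy _
      rw [metricInChart_apply, metricInChart_apply, ← hf.isometry (φ.symm y), ← hD, ← hD]
      simp only [Function.comp_apply]
      rw [φ.left_inv hfy]
      rfl
  filter_upwards [(φ.continuousAt hx₀).eventually hev, φ.open_source.mem_nhds hx₀,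
    hfφ.continuousAt.eventually_mem (φ.open_source.mem_nhds (by rwa [hfx]))] with x hx hxs hfxs
  refine φ.injOn hfxs hxs ?_
  simpa [φ.left_inv hxs] using hx

/-- The set of points near which `f` is the identity is open; it is closed because at a limit point
the `1`-jet of `f` is that of the identity. -/
theorem IsIsometryFixing.eq_one [T2Space M] [ConnectedSpace M] {f : Equiv.Perm M}
    (hf : IsIsometryFixing g O f) (hφ : φ ∈ IsManifold.maximalAtlas 𝓘(ℝ, Vec p q) ∞ M)
    (hO : O ∈ φ.source) (hf' : jacobian φ f O = 1) : f = 1 := by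
  let S : Set M := {x | ∀ᶠ y in 𝓝 x, f y = y}
  have hSo : IsOpen S := isOpen_setOfPred_eventually_nhds
  have hSc : IsClosed S := by
    refine isClosed_of_closure_subset fun x hx ↦ ?_
    have hfx : f x = x := by
      have h1 : IsClosed {x | f x = x} := isClosed_eq hf.smooth.continuous continuous_id
      exact closure_minimal (fun y hy ↦ hy.self_of_nhds) h1 hx
    set ψ := chartAt (Vec p q) x with hψ
    have hψa : ψ ∈ IsManifold.maximalAtlas 𝓘(ℝ, Vec p q) ∞ M :=
      IsManifold.chart_mem_maximalAtlas x
    have hxs : x ∈ ψ.source := mem_chart_source _ x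
    refine hf.eventually_eq_self hψa hxs hfx ?_
    have hc : ContinuousAt (fun y ↦ fderiv ℝ (ψ ∘ f ∘ ψ.symm) (ψ y)) x := by
      refine ContinuousAt.comp ?_ (ψ.continuousAt hxs)
      exact ((contDiffAt_chart_conj hψa hf.smooth hxs (by rwa [hfx])).fderiv_right (m := 0)
        (by simp)).continuousAt
    refine isClosed_singleton.mem_of_frequently_of_tendsto ?_ hc
    refine ((mem_closure_iff_frequently.1 hx).and_eventually (ψ.open_source.mem_nhds hxs)).mono ?_
    rintro y ⟨hy, hys⟩
    have h2 : (ψ ∘ f ∘ ψ.symm : Vec p q → Vec p q) =ᶠ[𝓝 (ψ y)] id := by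
      have h3 : ∀ᶠ z in 𝓝 (ψ y), f (ψ.symm z) = ψ.symm z := by
        refine (ψ.continuousAt_symm (ψ.map_source hys)).eventually (p := fun z ↦ f z = z) ?_
        rwa [ψ.left_inv hys]
      filter_upwards [h3, ψ.open_target.mem_nhds (ψ.map_source hys)] with z hz hzt
      simp [hz, ψ.right_inv hzt]
    rw [mem_singleton_iff, h2.fderiv_eq, fderiv_id]
    rfl
  have hOS : O ∈ S := by
    refine hf.eventually_eq_self hφ hO hf.fixes ?_
    have h1 : LinearMap.toMatrix' (fderiv ℝ (φ ∘ f ∘ φ.symm) (φ O) : Vec p q →ₗ[ℝ] Vec p q) =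
      LinearMap.toMatrix' LinearMap.id := hf'.trans LinearMap.toMatrix'_id.symm
    ext1 v
    exact congrArg (fun L : Vec p q →ₗ[ℝ] Vec p q ↦ L v) (LinearMap.toMatrix'.injective h1)
  have hS : S = univ := IsClopen.eq_univ ⟨hSc, hSo⟩ ⟨O, hOS⟩
  ext x
  exact (hS ▸ mem_univ x : x ∈ S).self_of_nhds

end Isometries

/-! ### Tetrads and the action of `K_O` -/

section Action

set_option maxSynthPendingDepth 3

theorem matrix_eq_of_dotProduct_mulVec {n : Type*} [Fintype n] [DecidableEq n] {A B : Matrix n n ℝ}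
    (h : ∀ v w : n → ℝ, v ⬝ᵥ (A *ᵥ w) = v ⬝ᵥ (B *ᵥ w)) : A = B := by
  ext i j
  simpa using h (Pi.single i 1) (Pi.single j 1)

variable {p q : ℕ} {M : Type*} [TopologicalSpace M] [ChartedSpace (Vec p q) M]
  [IsManifold 𝓘(ℝ, Vec p q) ∞ M] {g : SemiRiemannianMetric p q M} {O : M}
  {φ : OpenPartialHomeomorph M (Vec p q)} {σ : M → Mat p q}

theorem IsTetrad.det_ne_zero (hσ : IsTetrad g φ σ) {x : M} (hx : x ∈ φ.source) :
    (σ x).det ≠ 0 := by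
  obtain ⟨b, hb⟩ := g.signature x
  let N : Mat p q := Matrix.of fun i j ↦ coords φ x (b j) i
  have h : Nᵀ * ((σ x)ᵀ * Ipq p q * σ x) * N = Ipq p q := by
    ext i j
    rw [← hb i j, hσ.metric_eq x hx, Matrix.mul_assoc, Matrix.mul_apply_eq_vecMul,
      Matrix.vecMul_eq_sum]
    simp [N, dotProduct, Matrix.mul_apply, Matrix.mulVec]
  intro h0
  have := congrArg Matrix.det h
  simp only [Matrix.det_mul, h0, mul_zero, zero_mul] at this
  exact Ipq_det_ne_zero this.symm

theorem IsTetrad.mul_inv (hσ : IsTetrad g φ σ) {x : M} (hx : x ∈ φ.source) :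
    σ x * (σ x)⁻¹ = 1 :=
  Matrix.mul_nonsing_inv _ (isUnit_iff_ne_zero.2 (hσ.det_ne_zero hx))

theorem IsTetrad.inv_mul (hσ : IsTetrad g φ σ) {x : M} (hx : x ∈ φ.source) :
    (σ x)⁻¹ * σ x = 1 :=
  Matrix.nonsing_inv_mul _ (isUnit_iff_ne_zero.2 (hσ.det_ne_zero hx))

/-- In the tetrad frames, the differential of an isometry is a pseudo-orthogonal matrix. -/
theorem IsTetrad.isPseudoOrthogonal (hσ : IsTetrad g φ σ)
    (hφ : φ.MDifferentiable 𝓘(ℝ, Vec p q) 𝓘(ℝ, Vec p q)) {f : Equiv.Perm M}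
    (hf : IsIsometryFixing g O f) {x : M} (hx : x ∈ φ.source) (hfx : f x ∈ φ.source) :
    IsPseudoOrthogonal (σ (f x) * jacobian φ f x * (σ x)⁻¹) := by
  set J := jacobian φ f x with hJ
  have h : Jᵀ * ((σ (f x))ᵀ * Ipq p q * σ (f x)) * J = (σ x)ᵀ * Ipq p q * σ x := by
    refine matrix_eq_of_dotProduct_mulVec fun v w ↦ ?_
    obtain ⟨v, rfl⟩ := coords_surjective hφ hx v
    obtain ⟨w, rfl⟩ := coords_surjective hφ hx w
    have hfd := hf.smooth.mdifferentiable (by simp) x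
    rw [← hσ.metric_eq x hx, ← hf.isometry x, hσ.metric_eq _ hfx, coords_mfderiv hφ hx hfx hfd,
      coords_mfderiv hφ hx hfx hfd, ← hJ, Matrix.mul_assoc, ← Matrix.mulVec_mulVec,
      Matrix.dotProduct_mulVec _ Jᵀ, Matrix.vecMul_transpose, Matrix.mulVec_mulVec]
  unfold IsPseudoOrthogonal
  have h1 : ((σ x)⁻¹)ᵀ * (σ x)ᵀ = 1 := by
    rw [← Matrix.transpose_mul, hσ.mul_inv hx, Matrix.transpose_one]
  calc (σ (f x) * J * (σ x)⁻¹)ᵀ * Ipq p q * (σ (f x) * J * (σ x)⁻¹)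
      = ((σ x)⁻¹)ᵀ * (Jᵀ * ((σ (f x))ᵀ * Ipq p q * σ (f x)) * J) * (σ x)⁻¹ := by
        simp only [Matrix.transpose_mul, Matrix.mul_assoc]
    _ = (((σ x)⁻¹)ᵀ * (σ x)ᵀ) * Ipq p q * (σ x * (σ x)⁻¹) := by
        rw [h]
        simp only [Matrix.mul_assoc]
    _ = Ipq p q := by rw [h1, hσ.mul_inv hx, Matrix.one_mul, Matrix.mul_one]

variable {ξ : ∀ x : M, TangentSpace 𝓘(ℝ, Vec p q) x} {Fl : ℝ → Equiv.Perm M}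

/-- The field `ξ` vanishes at `O`, as its flow fixes `O`; so the differential of the flow at `O` is
the exponential of the linearization of `ξ`. -/
theorem IsKillingFlow.jacobian_flow [T2Space M] (h : IsKillingFlow g O ξ Fl)
    (hφ : φ ∈ IsManifold.maximalAtlas 𝓘(ℝ, Vec p q) ∞ M) (hO : O ∈ φ.source) (hφO : φ O = 0)
    {t : ℝ} (ht : t ∈ Icc (0 : ℝ) 1) :
    jacobian φ (Fl t) O = NormedSpace.exp (t • vectorFieldJacobian φ ξ O) := by
  have hφd := mdifferentiable_of_mem_maximalAtlas hφ
  have h0 : (0 : Vec p q) ∈ φ.target := hφO ▸ φ.map_source hO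
  have hF : HasFDerivAt (localField φ ξ) (fderiv ℝ (localField φ ξ) (φ O)) 0 := by
    rw [hφO]
    exact (((contDiffOn_localField hφ h.smooth).contDiffAt
      (φ.open_target.mem_nhds h0)).differentiableAt (by simp)).hasFDerivAt
  have hfix : ∀ t, Fl t O = O := fun t ↦ (h.isometry t).fixes
  have hF0 : localField φ ξ 0 = 0 := by
    have h1 := hasDerivAt_integralCurve (t := 0) hφd (h.flow O) (by simpa [hfix] using hO)
    simp only [hfix, hφO] at h1
    exact h1.unique (hasDerivAt_const _ _)
  have h2 := hasFDerivAt_flow hφd h0 hF hF0 (Fl := fun t ↦ Fl t) (fun x ↦ by simp [h.flow_zero])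
    h.flow ht (by rw [← hφO, φ.left_inv hO]; exact hfix t)
  rw [jacobian, hφO, h2.fderiv, toMatrix'_exp]
  congr 1

theorem IsTetrad.conj_mul_conj_eq_one (hσ : IsTetrad g φ σ) {x : M} (hx : x ∈ φ.source)
    {A B : Mat p q}
    (h : A * B = 1) : (σ x * A * (σ x)⁻¹) * (σ x * B * (σ x)⁻¹) = 1 := by
  calc (σ x * A * (σ x)⁻¹) * (σ x * B * (σ x)⁻¹)
      = σ x * A * ((σ x)⁻¹ * σ x) * B * (σ x)⁻¹ := by simp only [Matrix.mul_assoc]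
    _ = σ x * (A * B) * (σ x)⁻¹ := by rw [hσ.inv_mul hx]; simp only [Matrix.mul_assoc,
          Matrix.one_mul]
    _ = 1 := by rw [h, Matrix.mul_one, hσ.mul_inv hx]

theorem IsIsometryFixing.jacobian_mul {f f' : Equiv.Perm M} (hf : IsIsometryFixing g O f)
    (hf' : IsIsometryFixing g O f') (hφ : φ.MDifferentiable 𝓘(ℝ, Vec p q) 𝓘(ℝ, Vec p q)) {x : M}
    (hx : x ∈ φ.source) (hfx : f' x ∈ φ.source) (hffx : f (f' x) ∈ φ.source) :
    jacobian φ (f * f' : Equiv.Perm M) x = jacobian φ f (f' x) * jacobian φ f' x :=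
  jacobian_comp hφ hx hfx hffx (hf.smooth.mdifferentiable (by simp) _)
    (hf'.smooth.mdifferentiable (by simp) _)

theorem IsIsometryFixing.jacobian_inv_mul {f : Equiv.Perm M} (hf : IsIsometryFixing g O f)
    (hφ : φ.MDifferentiable 𝓘(ℝ, Vec p q) 𝓘(ℝ, Vec p q)) (hO : O ∈ φ.source) :
    jacobian φ (f⁻¹ : Equiv.Perm M) O * jacobian φ f O = 1 := by
  have h := hf.inv.jacobian_mul hf hφ hO (by rwa [hf.fixes]) (by rwa [hf.fixes, hf.inv.fixes])
  rw [hf.fixes, inv_mul_cancel] at h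
  exact h.symm.trans (jacobian_id hO)

/-- The elements `(a, f)` of the action graph: `f` is an isometry fixing `O` whose differential at
`O` is `a` in the tetrad frame, and multiplication by `a` preserves `SO⁺(p,q)`, because each
generator is joined to the identity by the path `t ↦ T_O Fl_t` of pseudo-orthogonal matrices. -/
theorem mem_actionGraph [T2Space M] (hφ : φ ∈ IsManifold.maximalAtlas 𝓘(ℝ, Vec p q) ∞ M)
    (hO : O ∈ φ.source) (hφO : φ O = 0) (hσ : IsTetrad g φ σ)
    {a : GL (Fin p ⊕ Fin q) ℝ × Equiv.Perm M} (ha : a ∈ actionGraph g φ σ O) :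
    IsIsometryFixing g O a.2 ∧ (a.1 : Mat p q) = σ O * jacobian φ a.2 O * (σ O)⁻¹ ∧
      ∀ B : Mat p q, IsSOPlus B ↔ IsSOPlus ((a.1 : Mat p q) * B) := by
  have hφd := mdifferentiable_of_mem_maximalAtlas hφ
  unfold actionGraph at ha
  induction ha using Subgroup.closure_induction with
  | mem a ha =>
    obtain ⟨ξ, Fl, h, ha1, ha2⟩ := ha
    set J := vectorFieldJacobian φ ξ O with hJ
    have hJt : ∀ t ∈ Icc (0 : ℝ) 1, jacobian φ (Fl t) O = NormedSpace.exp (t • J) :=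
      fun t ht ↦ h.jacobian_flow hφ hO hφO ht
    have h1 : jacobian φ (Fl 1) O = NormedSpace.exp J := by simpa using hJt 1 (by simp)
    have hJneg : NormedSpace.exp (-J) * NormedSpace.exp J = 1 := by
      rw [← Matrix.exp_add_of_commute _ _ (Commute.refl J).neg_left, neg_add_cancel,
        NormedSpace.exp_zero]
    have hinv : jacobian φ ((Fl 1)⁻¹ : Equiv.Perm M) O = NormedSpace.exp (-J) := by
      have h2 := (h.isometry 1).jacobian_inv_mul hφd hO
      rw [h1] at h2
      exact left_inv_eq_right_inv h2 (mul_eq_one_comm.1 hJneg)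
    refine ⟨ha2 ▸ (h.isometry 1).inv, by rw [ha1, ha2, hinv, psi], fun B ↦ ?_⟩
    let Γ : ℝ → Mat p q := fun t ↦ σ O * NormedSpace.exp (t • J) * (σ O)⁻¹
    have hΓ : Continuous Γ := by
      have hexp : Continuous fun t : ℝ ↦ (NormedSpace.exp (t • J) : Mat p q) := by
        open scoped Matrix.Norms.Operator in
        exact continuous_iff_continuousAt.2 fun t ↦ (hasDerivAt_exp_smul_const J t).continuousAt
      exact (continuous_const.mul hexp).mul continuous_const
    have hΓO : ∀ t ∈ Icc (0 : ℝ) 1, IsPseudoOrthogonal (Γ t) := fun t ht ↦ by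
      have := hσ.isPseudoOrthogonal hφd (h.isometry t) hO (by rwa [(h.isometry t).fixes])
      rwa [(h.isometry t).fixes, hJt t ht] at this
    have hΓ0 : Γ 0 = 1 := by simp [Γ, hσ.mul_inv hO]
    have hΓ1 : Γ 1 * a.1 = 1 := by
      rw [ha1, psi]
      simpa [Γ] using hσ.conj_mul_conj_eq_one hO (mul_eq_one_comm.1 hJneg)
    -- `Γ` joins `B` to `a⁻¹ B` inside `O(p,q)`
    have key : ∀ B : Mat p q, IsPseudoOrthogonal B → (IsSOPlus B ↔ IsSOPlus (Γ 1 * B)) := by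
      intro B hB
      have hc : ContinuousOn (fun t ↦ Γ t * B) (Icc 0 1) :=
        (hΓ.mul continuous_const).continuousOn
      have hOB : ∀ t ∈ Icc (0 : ℝ) 1, IsPseudoOrthogonal (Γ t * B) := fun t ht ↦
        (hΓO t ht).mul hB
      constructor
      · intro hB
        exact IsSOPlus.of_isPreconnected isPreconnected_Icc hc hOB (a := 0) (b := 1) (by simp)
          (by simp) (by simpa [hΓ0] using hB)
      · intro hB
        have := IsSOPlus.of_isPreconnected isPreconnected_Icc hc hOB (a := 1) (b := 0) (by simp)
          (by simp) hB
        simpa [hΓ0] using this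
    have haO : IsPseudoOrthogonal (a.1 : Mat p q) := by
      have h2 : IsPseudoOrthogonal (Γ 1) := hΓO 1 (by simp)
      have h3 : (Γ 1 * (a.1 : Mat p q))ᵀ * Ipq p q * (Γ 1 * (a.1 : Mat p q)) = Ipq p q := by
        simp [hΓ1]
      have h4 : (a.1 : Mat p q)ᵀ * ((Γ 1)ᵀ * Ipq p q * Γ 1) * a.1 = Ipq p q := by
        simpa only [Matrix.transpose_mul, Matrix.mul_assoc] using h3
      rwa [h2] at h4
    constructor
    · intro hB
      refine (key _ (haO.mul hB.1)).2 ?_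
      rwa [← Matrix.mul_assoc, hΓ1, Matrix.one_mul]
    · intro hB
      have := (key _ hB.1).1 hB
      rwa [← Matrix.mul_assoc, hΓ1, Matrix.one_mul] at this
  | one =>
    refine ⟨IsIsometryFixing.one, ?_, fun B ↦ by simp⟩
    have : jacobian φ ((1 : GL (Fin p ⊕ Fin q) ℝ × Equiv.Perm M).2) O = 1 := jacobian_id hO
    rw [this, Matrix.mul_one, hσ.mul_inv hO]
    rfl
  | mul a b _ _ ha hb =>
    obtain ⟨ha1, ha2, ha3⟩ := ha
    obtain ⟨hb1, hb2, hb3⟩ := hb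
    refine ⟨ha1.mul hb1, ?_, fun B ↦ ?_⟩
    · have := ha1.jacobian_mul hb1 hφd hO (by rwa [hb1.fixes]) (by rwa [hb1.fixes, ha1.fixes])
      rw [hb1.fixes] at this
      rw [Prod.snd_mul, this, Prod.fst_mul, Units.val_mul, ha2, hb2]
      calc _ = σ O * jacobian φ a.2 O * ((σ O)⁻¹ * σ O) * jacobian φ b.2 O * (σ O)⁻¹ := by
            simp only [Matrix.mul_assoc]
        _ = _ := by rw [hσ.inv_mul hO]; simp only [Matrix.mul_assoc, Matrix.one_mul]
    · rw [hb3, ha3, Prod.fst_mul, Units.val_mul, Matrix.mul_assoc]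
  | inv a _ ha =>
    obtain ⟨ha1, ha2, ha3⟩ := ha
    refine ⟨ha1.inv, ?_, fun B ↦ ?_⟩
    · have h1 := hσ.conj_mul_conj_eq_one hO (ha1.jacobian_inv_mul hφd hO)
      rw [← ha2] at h1
      rw [Prod.fst_inv, Matrix.coe_units_inv]
      exact Matrix.inv_eq_left_inv h1
    · rw [ha3 (_ * B), ← Matrix.mul_assoc, Prod.fst_inv, ← Units.val_mul, mul_inv_cancel,
        Units.val_one, Matrix.one_mul]

theorem leftAct_mem (Λ : KO g φ σ O) :
    ((Λ : GL (Fin p ⊕ Fin q) ℝ), leftAct Λ) ∈ actionGraph g φ σ O :=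
  (exists_mem_actionGraph Λ).choose_spec

/-- The action is multiplicative: an element of the action graph is determined by its matrix, as
this matrix determines the differential at `O` of the isometry. -/
theorem leftAct_mul [T2Space M] [ConnectedSpace M]
    (hφ : φ ∈ IsManifold.maximalAtlas 𝓘(ℝ, Vec p q) ∞ M)
    (hO : O ∈ φ.source) (hφO : φ O = 0) (hσ : IsTetrad g φ σ) (Λ₁ Λ₂ : KO g φ σ O) :
    leftAct (Λ₁ * Λ₂) = leftAct Λ₁ * leftAct Λ₂ := by
  have h := mul_mem (leftAct_mem (Λ₁ * Λ₂)) (inv_mem (mul_mem (leftAct_mem Λ₁) (leftAct_mem Λ₂)))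
  obtain ⟨h1, h2, -⟩ := mem_actionGraph hφ hO hφO hσ h
  have h3 : jacobian φ (leftAct (Λ₁ * Λ₂) * (leftAct Λ₁ * leftAct Λ₂)⁻¹ : Equiv.Perm M) O = 1 := by
    have h4 : (1 : Mat p q) = σ O *
        jacobian φ (leftAct (Λ₁ * Λ₂) * (leftAct Λ₁ * leftAct Λ₂)⁻¹ : Equiv.Perm M) O *
          (σ O)⁻¹ := by
      rw [← Units.val_one, ← mul_inv_cancel ((Λ₁ * Λ₂ : KO g φ σ O) : GL (Fin p ⊕ Fin q) ℝ)]
      exact h2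
    calc _ = ((σ O)⁻¹ * σ O) * jacobian φ
          (leftAct (Λ₁ * Λ₂) * (leftAct Λ₁ * leftAct Λ₂)⁻¹ : Equiv.Perm M) O *
            ((σ O)⁻¹ * σ O) := by rw [hσ.inv_mul hO, Matrix.one_mul, Matrix.mul_one]
      _ = (σ O)⁻¹ * (σ O * jacobian φ
          (leftAct (Λ₁ * Λ₂) * (leftAct Λ₁ * leftAct Λ₂)⁻¹ : Equiv.Perm M) O * (σ O)⁻¹) * σ O := by
        simp only [Matrix.mul_assoc]
      _ = 1 := by rw [← h4, Matrix.mul_one, hσ.inv_mul hO]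
  exact mul_inv_eq_one.1 (h1.eq_one hφ hO h3)

theorem isIsometryFixing_leftAct [T2Space M]
    (hφ : φ ∈ IsManifold.maximalAtlas 𝓘(ℝ, Vec p q) ∞ M)
    (hO : O ∈ φ.source) (hφO : φ O = 0) (hσ : IsTetrad g φ σ) (Λ : KO g φ σ O) :
    IsIsometryFixing g O (leftAct Λ) :=
  (mem_actionGraph hφ hO hφO hσ (leftAct_mem Λ)).1

theorem jacobian_leftAct (hσ : IsTetrad g φ σ) (Λ : KO g φ σ O) {x : M} (hx : x ∈ φ.source)
    (hΛx : leftAct Λ x ∈ φ.source) :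
    jacobian φ (leftAct Λ) x = (σ (leftAct Λ x))⁻¹ * tilde Λ x * σ x := by
  calc _ = ((σ (leftAct Λ x))⁻¹ * σ (leftAct Λ x)) * jacobian φ (leftAct Λ) x *
          ((σ x)⁻¹ * σ x) := by
        rw [hσ.inv_mul hx, hσ.inv_mul hΛx, Matrix.one_mul, Matrix.mul_one]
    _ = _ := by
        unfold tilde
        simp only [Matrix.mul_assoc]

theorem tilde_base [T2Space M] (hφ : φ ∈ IsManifold.maximalAtlas 𝓘(ℝ, Vec p q) ∞ M)
    (hO : O ∈ φ.source) (hφO : φ O = 0) (hσ : IsTetrad g φ σ) (Λ : KO g φ σ O) :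
    tilde Λ O = ((Λ : GL (Fin p ⊕ Fin q) ℝ) : Mat p q) := by
  obtain ⟨h1, h2, -⟩ := mem_actionGraph hφ hO hφO hσ (leftAct_mem Λ)
  rw [tilde, h1.fixes]
  exact h2.symm

theorem isPseudoOrthogonal_tilde [T2Space M]
    (hφ : φ ∈ IsManifold.maximalAtlas 𝓘(ℝ, Vec p q) ∞ M)
    (hO : O ∈ φ.source) (hφO : φ O = 0) (hσ : IsTetrad g φ σ) (Λ : KO g φ σ O) {x : M}
    (hx : x ∈ φ.source) (hΛx : leftAct Λ x ∈ φ.source) : IsPseudoOrthogonal (tilde Λ x) :=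
  hσ.isPseudoOrthogonal (mdifferentiable_of_mem_maximalAtlas hφ)
    (isIsometryFixing_leftAct hφ hO hφO hσ Λ) hx hΛx

theorem IsTetrad.continuousOn (hσ : IsTetrad g φ σ) : ContinuousOn σ φ.source :=
  continuousOn_pi.2 fun i ↦ continuousOn_pi.2 fun j ↦ (hσ.smooth i j).continuousOn

theorem continuousOn_tilde [T2Space M] (hφ : φ ∈ IsManifold.maximalAtlas 𝓘(ℝ, Vec p q) ∞ M)
    (hO : O ∈ φ.source) (hφO : φ O = 0) (hσ : IsTetrad g φ σ) (Λ : KO g φ σ O) {W : Set M}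
    (hW : W ⊆ φ.source) (hΛW : MapsTo (leftAct Λ) W φ.source) : ContinuousOn (tilde Λ) W := by
  have hf := isIsometryFixing_leftAct hφ hO hφO hσ Λ
  have h1 : ContinuousOn (fun x ↦ σ (leftAct Λ x)) W :=
    hσ.continuousOn.comp hf.smooth.continuous.continuousOn hΛW
  have h2 : ContinuousOn (fun x ↦ jacobian φ (leftAct Λ) x) W := by
    intro x hx
    have h3 : ContinuousAt (fun x ↦ fderiv ℝ (φ ∘ leftAct Λ ∘ φ.symm) (φ x)) x := by
      refine ContinuousAt.comp ?_ (φ.continuousAt (hW hx))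
      exact ((contDiffAt_chart_conj hφ hf.smooth (hW hx) (hΛW hx)).fderiv_right (m := 0)
        (by simp)).continuousAt
    let Φ : (Vec p q →L[ℝ] Vec p q) →ₗ[ℝ] Mat p q :=
      (LinearMap.toMatrix' : (Vec p q →ₗ[ℝ] Vec p q) ≃ₗ[ℝ] Mat p q).toLinearMap ∘ₗ
        ContinuousLinearMap.coeLM ℝ
    have hΦ : Continuous Φ := Φ.continuous_of_finiteDimensional
    exact (hΦ.continuousAt.comp h3).continuousWithinAt
  have h4 : ContinuousOn (fun x ↦ (σ x)⁻¹) W := by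
    simp only [Matrix.inv_def, Ring.inverse_eq_inv']
    have h5 := hσ.continuousOn.mono hW
    have h6 : ContinuousOn (fun x ↦ (σ x).det) W :=
      (Continuous.matrix_det continuous_id).comp_continuousOn h5
    have h7 : ContinuousOn (fun x ↦ (σ x).adjugate) W :=
      (Continuous.matrix_adjugate continuous_id).comp_continuousOn h5
    exact (h6.inv₀ fun x hx ↦ hσ.det_ne_zero (hW hx)).smul h7
  exact (h1.mul h2).mul h4

theorem isSOPlus_tilde [T2Space M] (hφ : φ ∈ IsManifold.maximalAtlas 𝓘(ℝ, Vec p q) ∞ M)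
    (hO : O ∈ φ.source) (hφO : φ O = 0) (hσ : IsTetrad g φ σ) (Λ : KO g φ σ O) {W : Set M}
    (hWc : IsPreconnected W) (hOW : O ∈ W) (hW : W ⊆ φ.source)
    (hΛW : MapsTo (leftAct Λ) W φ.source) {x : M} (hx : x ∈ W) : IsSOPlus (tilde Λ x) := by
  refine IsSOPlus.of_isPreconnected hWc (continuousOn_tilde hφ hO hφO hσ Λ hW hΛW)
    (fun y hy ↦ isPseudoOrthogonal_tilde hφ hO hφO hσ Λ (hW hy) (hΛW hy)) hOW hx ?_
  rw [tilde_base hφ hO hφO hσ]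
  simpa using ((mem_actionGraph hφ hO hφO hσ (leftAct_mem Λ)).2.2 1).1 isSOPlus_one

theorem tilde_mul [T2Space M] [ConnectedSpace M]
    (hφ : φ ∈ IsManifold.maximalAtlas 𝓘(ℝ, Vec p q) ∞ M)
    (hO : O ∈ φ.source) (hφO : φ O = 0) (hσ : IsTetrad g φ σ) (Λ₁ Λ₂ : KO g φ σ O) {x : M}
    (hx : x ∈ φ.source) (hx₂ : leftAct Λ₂ x ∈ φ.source)
    (hx₁₂ : leftAct (Λ₁ * Λ₂) x ∈ φ.source) :
    tilde (Λ₁ * Λ₂) x = tilde Λ₁ (leftAct Λ₂ x) * tilde Λ₂ x := by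
  have hmul := leftAct_mul hφ hO hφO hσ Λ₁ Λ₂
  rw [hmul, Equiv.Perm.mul_apply] at hx₁₂
  have hJ := (isIsometryFixing_leftAct hφ hO hφO hσ Λ₁).jacobian_mul
    (isIsometryFixing_leftAct hφ hO hφO hσ Λ₂) (mdifferentiable_of_mem_maximalAtlas hφ) hx hx₂ hx₁₂
  unfold tilde
  rw [hmul, hJ, Equiv.Perm.mul_apply]
  calc _ = σ (leftAct Λ₁ (leftAct Λ₂ x)) * jacobian φ (leftAct Λ₁) (leftAct Λ₂ x) * 1 *
        jacobian φ (leftAct Λ₂) x * (σ x)⁻¹ := by simp only [Matrix.mul_assoc, Matrix.one_mul]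
    _ = _ := by
      rw [← hσ.inv_mul hx₂]
      simp only [Matrix.mul_assoc]

end Action

/-! ### Equivariance of the local connection form -/

section Connection

variable {p q : ℕ} {M : Type*} [TopologicalSpace M] [ChartedSpace (Vec p q) M]
  [IsManifold 𝓘(ℝ, Vec p q) ∞ M] {g : SemiRiemannianMetric p q M} {O : M}
  {φ : OpenPartialHomeomorph M (Vec p q)} {σ : M → Mat p q}
  {EG : Type*} [NormedAddCommGroup EG] [NormedSpace ℝ EG]
  {G : Type*} [Group G] [TopologicalSpace G] [ChartedSpace EG G]
  {EP : Type*} [NormedAddCommGroup EP] [NormedSpace ℝ EP]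
  {P : Type*} [TopologicalSpace P] [ChartedSpace EP P] [IsManifold 𝓘(ℝ, EP) ∞ P]
  [MulAction Gᵐᵒᵖ P]

/-- The gauge transformation `A^{s·a} = Ad(a⁻¹) ∘ A^s` by a constant `a`. -/
theorem ConnectionForm.localForm_act {EM : Type*} [NormedAddCommGroup EM] [NormedSpace ℝ EM]
    {N : Type*} [TopologicalSpace N] [ChartedSpace EM N] (A : ConnectionForm EG G EP P) {s : N → P}
    {x : N} (hs : MDifferentiableAt 𝓘(ℝ, EM) 𝓘(ℝ, EP) s x) (a : G)
    (ha : MDifferentiableAt 𝓘(ℝ, EP) 𝓘(ℝ, EP) (fun u : P ↦ u <• a) (s x)) :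
    A.localForm (EM := EM) (fun y ↦ s y <• a) x =
      (Ad (EG := EG) a⁻¹).comp (A.localForm (EM := EM) s x) := by
  unfold ConnectionForm.localForm
  have h := mfderiv_comp x (g := fun u : P ↦ u <• a) (f := s) ha hs
  rw [show (fun y ↦ s y <• a) = (fun u : P ↦ u <• a) ∘ s from rfl, h]
  exact congrArg (fun L : TangentSpace 𝓘(ℝ, EP) (s x) →L[ℝ] GroupLieAlgebra 𝓘(ℝ, EG) G ↦
    L.comp (mfderiv 𝓘(ℝ, EM) 𝓘(ℝ, EP) s x)) (A.equivariant (s x) a)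

/-- The definition of an adapted equivariant section for `Λ⁻¹` compares `Ad(Λ) ∘ A^s` with the
pull-back of `A^s` by `L_Λ`. -/
theorem localForm_comp_mfderiv_leftAct [T2Space M]
    (hφ : φ ∈ IsManifold.maximalAtlas 𝓘(ℝ, Vec p q) ∞ M)
    (hO : O ∈ φ.source) (hφO : φ O = 0) (hσ : IsTetrad g φ σ) (ι : G →* KO g φ σ O)
    {π : P → M} (hπ : IsPrincipalBundle EG G (Vec p q) EP π) (A : ConnectionForm EG G EP P)
    {s : M → P} (hs : ContMDiffOn 𝓘(ℝ, Vec p q) 𝓘(ℝ, EP) ∞ s φ.source)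
    (hequiv : IsAdaptedEquivariant (Vec p q) A (fun a ↦ rightAct (ι a)) s φ.source) (Λ : G) {x : M}
    (hx : x ∈ φ.source) (hΛx : leftAct (ι Λ) x ∈ φ.source) :
    (A.localForm s (leftAct (ι Λ) x)).comp
        (mfderiv 𝓘(ℝ, Vec p q) 𝓘(ℝ, Vec p q) (leftAct (ι Λ)) x) =
      (Ad (EG := EG) Λ).comp (A.localForm s x) := by
  have hR : rightAct (ι Λ⁻¹) = leftAct (ι Λ) := by rw [rightAct, map_inv, inv_inv]
  have hsd : ∀ y ∈ φ.source, MDifferentiableAt 𝓘(ℝ, Vec p q) 𝓘(ℝ, EP) s y := fun y hy ↦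
    (hs.contMDiffAt (φ.open_source.mem_nhds hy)).mdifferentiableAt (by simp)
  have h := hequiv Λ⁻¹ x hx (by simpa only [hR] using hΛx)
  simp only [hR] at h
  rw [A.localForm_act (hsd x hx) Λ⁻¹ ((hπ.smooth_act _).mdifferentiable (by simp) _), inv_inv] at h
  rw [h]
  unfold ConnectionForm.localForm
  rw [mfderiv_comp x (hsd _ hΛx)
    ((isIsometryFixing_leftAct hφ hO hφO hσ (ι Λ)).smooth.mdifferentiable (by simp) _)]
  rfl

theorem localForm_leftAct [T2Space M]
    (hφ : φ ∈ IsManifold.maximalAtlas 𝓘(ℝ, Vec p q) ∞ M)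
    (hO : O ∈ φ.source) (hφO : φ O = 0) (hσ : IsTetrad g φ σ) (ι : G →* KO g φ σ O)
    {π : P → M} (hπ : IsPrincipalBundle EG G (Vec p q) EP π) (A : ConnectionForm EG G EP P)
    {s : M → P} (hs : ContMDiffOn 𝓘(ℝ, Vec p q) 𝓘(ℝ, EP) ∞ s φ.source)
    (hequiv : IsAdaptedEquivariant (Vec p q) A (fun a ↦ rightAct (ι a)) s φ.source) (Λ : G) {x : M}
    (hx : x ∈ φ.source) (hΛx : leftAct (ι Λ) x ∈ φ.source) :
    A.localForm s (leftAct (ι Λ) x) = (Ad (EG := EG) Λ).comp ((A.localForm s x).comp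
      (mfderiv 𝓘(ℝ, Vec p q) 𝓘(ℝ, Vec p q) (leftAct (ι Λ)) x).inverse) := by
  have hinv := (isIsometryFixing_leftAct hφ hO hφO hσ (ι Λ)).mfderiv_isInvertible x
  have h := localForm_comp_mfderiv_leftAct hφ hO hφO hσ ι hπ A hs hequiv Λ hx hΛx
  rw [← ContinuousLinearMap.comp_assoc, ← h, ContinuousLinearMap.comp_assoc,
    hinv.self_comp_inverse]
  rfl

/-- `T_x L` maps `∑_κ [J⁻¹]_{κν} ∂_κ` to `∂_ν`, where `J` is the Jacobian of `L` at `x`. -/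
theorem IsIsometryFixing.mfderiv_sum_smul_coordVector
    (hφ : φ.MDifferentiable 𝓘(ℝ, Vec p q) 𝓘(ℝ, Vec p q)) {f : Equiv.Perm M}
    (hf : IsIsometryFixing g O f) {x : M} (hx : x ∈ φ.source) (hfx : f x ∈ φ.source)
    {N : Mat p q} (hN : jacobian φ f x * N = 1) (ν : Fin p ⊕ Fin q) :
    (mfderiv 𝓘(ℝ, Vec p q) 𝓘(ℝ, Vec p q) f x).inverse (coordVector φ (f x) ν) =
      ∑ κ, N κ ν • coordVector φ x κ := by
  obtain ⟨v, hv⟩ := coords_surjective hφ hx (N *ᵥ Pi.single ν 1)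
  have h1 : mfderiv 𝓘(ℝ, Vec p q) 𝓘(ℝ, Vec p q) f x v = coordVector φ (f x) ν := by
    refine coords_injective hφ hfx ?_
    rw [coords_mfderiv hφ hx hfx (hf.smooth.mdifferentiable (by simp) _), hv,
      coords_coordVector hφ hfx, Matrix.mulVec_mulVec, hN, Matrix.one_mulVec]
  rw [← h1, (hf.mfderiv_isInvertible x).inverse_apply_self, ← sum_smul_coordVector hφ hx v, hv]
  simp

theorem omega_leftAct [T2Space M]
    (hφ : φ ∈ IsManifold.maximalAtlas 𝓘(ℝ, Vec p q) ∞ M)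
    (hO : O ∈ φ.source) (hφO : φ O = 0) (hσ : IsTetrad g φ σ) (ι : G →* KO g φ σ O)
    {π : P → M} (hπ : IsPrincipalBundle EG G (Vec p q) EP π) (A : ConnectionForm EG G EP P)
    {s : M → P} (hs : ContMDiffOn 𝓘(ℝ, Vec p q) 𝓘(ℝ, EP) ∞ s φ.source)
    (hequiv : IsAdaptedEquivariant (Vec p q) A (fun a ↦ rightAct (ι a)) s φ.source) (Λ : G) {x : M}
    (hx : x ∈ φ.source) (hΛx : leftAct (ι Λ) x ∈ φ.source) (μ : Fin p ⊕ Fin q) :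
    omega φ σ (A.localForm s) μ (leftAct (ι Λ) x) =
      ∑ ν, (tilde (ι Λ) x)⁻¹ ν μ • Ad (EG := EG) Λ (omega φ σ (A.localForm s) ν x) := by
  have hφd := mdifferentiable_of_mem_maximalAtlas hφ
  have hf := isIsometryFixing_leftAct hφ hO hφO hσ (ι Λ)
  set T := tilde (ι Λ) x with hT
  set y := leftAct (ι Λ) x with hy
  have hTdet : IsUnit T.det := by
    have := (isPseudoOrthogonal_tilde hφ hO hφO hσ (ι Λ) hx hΛx).det_sq
    exact isUnit_iff_ne_zero.2 fun h ↦ by simp [← hT, h] at this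
  -- the inverse of the Jacobian `σ(y)⁻¹ Λ̃(x) σ(x)`
  let N : Mat p q := (σ x)⁻¹ * T⁻¹ * σ y
  have hN : jacobian φ (leftAct (ι Λ)) x * N = 1 := by
    rw [jacobian_leftAct hσ (ι Λ) hx hΛx]
    calc _ = (σ y)⁻¹ * T * (σ x * (σ x)⁻¹) * T⁻¹ * σ y := by
          simp only [N, ← hT, ← hy, Matrix.mul_assoc]
      _ = (σ y)⁻¹ * (T * T⁻¹) * σ y := by
          rw [hσ.mul_inv hx, Matrix.mul_one]; simp only [Matrix.mul_assoc]
      _ = 1 := by rw [Matrix.mul_nonsing_inv _ hTdet, Matrix.mul_one, hσ.inv_mul hΛx]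
  have hNσ : N * (σ y)⁻¹ = (σ x)⁻¹ * T⁻¹ := by
    calc _ = (σ x)⁻¹ * T⁻¹ * (σ y * (σ y)⁻¹) := by simp only [N, Matrix.mul_assoc]
      _ = _ := by rw [hσ.mul_inv hΛx, Matrix.mul_one]
  let b : Fin p ⊕ Fin q → GroupLieAlgebra 𝓘(ℝ, EG) G := fun κ ↦
    Ad (EG := EG) Λ (A.localForm s x (coordVector φ x κ))
  have hB : ∀ ν, A.localForm s y (coordVector φ y ν) = ∑ κ, N κ ν • b κ := fun ν ↦ by
    rw [localForm_leftAct hφ hO hφO hσ ι hπ A hs hequiv Λ hx hΛx]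
    simp only [ContinuousLinearMap.comp_apply]
    rw [hf.mfderiv_sum_smul_coordVector hφd hx hΛx hN]
    simp only [map_sum, map_smul]
    rfl
  have hω : ∀ ν, Ad (EG := EG) Λ (omega φ σ (A.localForm s) ν x) = ∑ κ, (σ x)⁻¹ κ ν • b κ :=
    fun ν ↦ by
      simp only [omega, map_sum, map_smul]
      rfl
  calc omega φ σ (A.localForm s) μ y
      = ∑ ν, (σ y)⁻¹ ν μ • ∑ κ, N κ ν • b κ := by simp only [omega, hB]
    _ = ∑ κ, (N * (σ y)⁻¹) κ μ • b κ := by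
      simp only [Finset.smul_sum, smul_smul, Matrix.mul_apply, Finset.sum_smul]
      rw [Finset.sum_comm]
      simp only [mul_comm]
    _ = ∑ ν, T⁻¹ ν μ • ∑ κ, (σ x)⁻¹ κ ν • b κ := by
      rw [hNσ]
      simp only [Finset.smul_sum, smul_smul, Matrix.mul_apply, Finset.sum_smul]
      rw [Finset.sum_comm]
      simp only [mul_comm]
    _ = _ := by simp only [hω]

end Connection

end EquivConn

end

theorem mainTheorem11
    -- a connected semi-Riemannian manifold of signature (p,q) with a point O
    {p q : ℕ} {M : Type*} [TopologicalSpace M] [ChartedSpace (EquivConn.Vec p q) M]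
    [IsManifold 𝓘(ℝ, EquivConn.Vec p q) ∞ M] [T2Space M] [ConnectedSpace M]
    (g : EquivConn.SemiRiemannianMetric p q M) (O : M)
    -- a chart centred at O, with tetrads
    (φ : OpenPartialHomeomorph M (EquivConn.Vec p q))
    (hφ : φ ∈ IsManifold.maximalAtlas 𝓘(ℝ, EquivConn.Vec p q) ∞ M)
    (hO : O ∈ φ.source) (hφO : φ O = 0)
    (σ : M → EquivConn.Mat p q) (hσ : EquivConn.IsTetrad g φ σ)
    -- a Lie subgroup G of K_O
    {EG : Type*} [NormedAddCommGroup EG] [NormedSpace ℝ EG] [FiniteDimensional ℝ EG]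
    {G : Type*} [Group G] [TopologicalSpace G] [ChartedSpace EG G] [LieGroup 𝓘(ℝ, EG) ∞ G]
    (ι : G →* EquivConn.KO g φ σ O) (hι : EquivConn.IsLieSubgroup (EG := EG) ι)
    -- a principal G-bundle over M with a connection form
    {EP : Type*} [NormedAddCommGroup EP] [NormedSpace ℝ EP] [FiniteDimensional ℝ EP]
    {P : Type*} [TopologicalSpace P] [ChartedSpace EP P] [IsManifold 𝓘(ℝ, EP) ∞ P]
    [MulAction Gᵐᵒᵖ P] (π : P → M)
    (hπ : EquivConn.IsPrincipalBundle EG G (EquivConn.Vec p q) EP π)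
    (A : EquivConn.ConnectionForm EG G EP P)
    -- an adapted G-equivariant section over the domain of the chart
    (s : M → P) (hs : ContMDiffOn 𝓘(ℝ, EquivConn.Vec p q) 𝓘(ℝ, EP) ∞ s φ.source)
    (hπs : ∀ x ∈ φ.source, π (s x) = x)
    (hequiv : EquivConn.IsAdaptedEquivariant (EquivConn.Vec p q) A
      (fun a ↦ EquivConn.rightAct (ι a)) s φ.source) :
    -- the induced matrices
    (∀ (Λ : G), ∀ x ∈ φ.source, EquivConn.leftAct (ι Λ) x ∈ φ.source →
      EquivConn.jacobian φ (EquivConn.leftAct (ι Λ)) x =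
        (σ (EquivConn.leftAct (ι Λ) x))⁻¹ * EquivConn.tilde (ι Λ) x * σ x) ∧
    (∀ Λ : G, EquivConn.tilde (ι Λ) O = ((ι Λ : GL (Fin p ⊕ Fin q) ℝ) : EquivConn.Mat p q)) ∧
    -- equivariance of the local form
    (∀ (Λ : G), ∀ x ∈ φ.source, EquivConn.leftAct (ι Λ) x ∈ φ.source →
      (mfderiv 𝓘(ℝ, EquivConn.Vec p q) 𝓘(ℝ, EquivConn.Vec p q)
        (EquivConn.leftAct (ι Λ)) x).IsInvertible ∧
      A.localForm s (EquivConn.leftAct (ι Λ) x) =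
        (EquivConn.Ad (EG := EG) Λ).comp ((A.localForm s x).comp
          (mfderiv 𝓘(ℝ, EquivConn.Vec p q) 𝓘(ℝ, EquivConn.Vec p q)
            (EquivConn.leftAct (ι Λ)) x).inverse)) ∧
    -- values in SO⁺(p,q)
    (∀ (Λ : G) (W : Set M), IsPreconnected W → O ∈ W → W ⊆ φ.source →
      Set.MapsTo (EquivConn.leftAct (ι Λ)) W φ.source →
      ∀ x ∈ W, EquivConn.IsSOPlus (EquivConn.tilde (ι Λ) x)) ∧
    -- cocycle rule
    (∀ (Λ₁ Λ₂ : G), ∀ x ∈ φ.source, EquivConn.leftAct (ι Λ₂) x ∈ φ.source →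
      EquivConn.leftAct (ι (Λ₁ * Λ₂)) x ∈ φ.source →
      EquivConn.tilde (ι (Λ₁ * Λ₂)) x =
        EquivConn.tilde (ι Λ₁) (EquivConn.leftAct (ι Λ₂) x) * EquivConn.tilde (ι Λ₂) x) ∧
    -- equivariance of the tetrad-weighted form
    (∀ (Λ : G), ∀ x ∈ φ.source, EquivConn.leftAct (ι Λ) x ∈ φ.source →
      ∀ μ : Fin p ⊕ Fin q,
        EquivConn.omega φ σ (A.localForm s) μ (EquivConn.leftAct (ι Λ) x) =
          ∑ ν, (EquivConn.tilde (ι Λ) x)⁻¹ ν μ •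
            EquivConn.Ad (EG := EG) Λ (EquivConn.omega φ σ (A.localForm s) ν x)) := by
  refine ⟨fun Λ x hx hΛx ↦ EquivConn.jacobian_leftAct hσ (ι Λ) hx hΛx,
    fun Λ ↦ EquivConn.tilde_base hφ hO hφO hσ (ι Λ), fun Λ x hx hΛx ↦ ⟨?_, ?_⟩,
    fun Λ W hWc hOW hW hΛW x hx ↦
      EquivConn.isSOPlus_tilde hφ hO hφO hσ (ι Λ) hWc hOW hW hΛW hx,
    fun Λ₁ Λ₂ x hx hx₂ hx₁₂ ↦ ?_, fun Λ x hx hΛx μ ↦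
      EquivConn.omega_leftAct hφ hO hφO hσ ι hπ A hs hequiv Λ hx hΛx μ⟩
  · exact (EquivConn.isIsometryFixing_leftAct hφ hO hφO hσ (ι Λ)).mfderiv_isInvertible x
  · exact EquivConn.localForm_leftAct hφ hO hφO hσ ι hπ A hs hequiv Λ hx hΛx
  · rw [map_mul] at hx₁₂ ⊢
    exact EquivConn.tilde_mul hφ hO hφO hσ (ι Λ₁) (ι Λ₂) hx hx₂ hx₁₂
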